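/- Fix a constant $E>0$. There are a constant $C$ and an exponent $k\in\mathbb{N}$, depending only on $E$, such that the following holds for all integers $d\ge 1$, $n\ge 1$ and all reals $0<\varepsilon\le E$, $\zeta,\delta\in(0,1/2)$. Each of $n$ users holds a $1$-sparse vector $v_i\in\mathbb{R}^d$ (at most one non-zero coordinate) with $\|v_i\|_2\le 1$, and the goal is to estimate $\sum_{i} v_i$. In a shuffle-model protocol every user applies the same local randomizer to its own input, with independent randomness, producing a multiset of messages; the shuffler outputs all messages of all users in a uniformly random order; the analyzer computes the estimate from the shuffler's output. The protocol is $(\varepsilon,\delta)$-DP if for any two datasets $X,X'$ that differ in at most one user's input and any set $S$ of possible shuffler outputs, the shuffler's output $V$ satisfies $\Pr[V(X)\in S]\le e^{\varepsilon}\Pr[V(X')\in S]+\delta$. Then there is an $(\varepsilon,\delta)$-DP shuffle-model protocol such that: 1. for every dataset, its $\ell_2$ error (the root mean square Euclidean distance between the estimate and $\sum_i v_i$) is at most that of the Laplace mechanism with parameter $a=(1-\zeta)\varepsilon/2$, which adds to each coordinate of $\sum_i v_i$ independent noise of density $\frac a2 e^{-a|t|}$; 2. on every input, the expected number of messages that a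 user sends is at most $$1+C\left(1+\log n+\tfrac1\varepsilon+\tfrac1\zeta\right)^{k}\cdot\frac{d\,\log(1/\delta)}{\sqrt n},$$ that is, $1+\tilde O_{\zeta,\varepsilon}\big(d\log(1/\delta)/\sqrt n\big)$, where $\tilde O_{\zeta,\varepsilon}$ hides a factor polynomial in $\log n$, $1/\varepsilon$, $1/\zeta$; 3. each message is a bit string of a fixed length $b\le \log_2 d+\tfrac12\log_2 n+C\log(1/\zeta)$. -/

import Mathlib

open scoped ENNReal
open MeasureTheory

noncomputable section

/-- Two datasets of `n` users are neighboring if they differ on at most a single user's input. -/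
def Neighboring {X : Type*} {n : ℕ} (x x' : Fin n → X) : Prop :=
  ∃ i : Fin n, ∀ j : Fin n, j ≠ i → x j = x' j

/-- `(ε, δ)`-differential privacy of a randomized algorithm on datasets of `n` inputs. -/
def IsDP {X Y : Type*} {n : ℕ} (A : (Fin n → X) → PMF Y) (ε δ : ℝ) : Prop :=
  ∀ x x' : Fin n → X, Neighboring x x' → ∀ S : Set Y,
    (A x).toOuterMeasure S ≤
      ENNReal.ofReal (Real.exp ε) * (A x').toOuterMeasure S + ENNReal.ofReal δ

/-- The shuffler: the elements of a multiset listed in a uniformly random order. -/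
def shuffler {M : Type*} (s : Multiset M) : PMF (List M) :=
  (PMF.uniformOfFintype (Equiv.Perm (Fin s.toList.length))).map
    fun σ => List.ofFn fun i => s.toList.get (σ i)

/-- A shuffle-model protocol with inputs in `X`, messages in `M` and outputs in `Y`: a local
randomizer, which every user runs on its own input, and an analyzer. -/
structure ShuffleProtocol (X M Y : Type*) where
  /-- The multiset of messages that a user sends. -/
  randomizer : X → PMF (Multiset M)
  /-- The output computed from the list of shuffled messages. -/
  analyzer : List M → Y

namespace ShuffleProtocol

variable {X M Y : Type*}

/-- The multiset of all messages sent by a list of users with independent randomness. -/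
def collect (P : ShuffleProtocol X M Y) : List X → PMF (Multiset M)
  | [] => PMF.pure 0
  | x :: xs => (P.randomizer x).bind fun s => (P.collect xs).map fun t => s + t

/-- The output of the shuffler on a dataset. -/
def view (P : ShuffleProtocol X M Y) {n : ℕ} (x : Fin n → X) : PMF (List M) :=
  (P.collect (List.ofFn x)).bind shuffler

/-- The output of the protocol on a dataset. -/
def output (P : ShuffleProtocol X M Y) {n : ℕ} (x : Fin n → X) : PMF Y :=
  (P.view x).map P.analyzer

/-- A protocol for `n` users is private if the output of the shuffler is. -/
def IsShuffleDP (P : ShuffleProtocol X M Y) (n : ℕ) (ε δ : ℝ) : Prop :=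
  IsDP (fun x : Fin n → X => P.view x) ε δ

/-- The expected number of messages sent by a user with input `x`. -/
def expectedMessages (P : ShuffleProtocol X M Y) (x : X) : ℝ≥0∞ :=
  ∑' s : Multiset M, P.randomizer x s * (Multiset.card s : ℝ≥0∞)

end ShuffleProtocol

/-- The `1`-sparse vectors of norm at most `1` in `ℝ^d`. -/
def OneSparse (d : ℕ) : Type :=
  {v : EuclideanSpace ℝ (Fin d) // {j | v j ≠ 0}.encard ≤ 1 ∧ ‖v‖ ≤ 1}

/-- The sum of the users' vectors. -/
def vectorSum {d n : ℕ} (v : Fin n → OneSparse d) : EuclideanSpace ℝ (Fin d) :=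
  ∑ i, (v i).val

/-- The Laplace distribution with parameter `a`, of density `(a / 2) exp (-a |t|)`. -/
def laplaceDistribution (a : ℝ) : Measure ℝ :=
  volume.withDensity fun t => ENNReal.ofReal (a / 2 * Real.exp (-(a * |t|)))

/-- The Laplace mechanism with parameter `a` for vector summation: the output distribution is that
of the true sum plus independent Laplace noise in each coordinate. -/
def laplaceMechanism (a : ℝ) {d n : ℕ} (v : Fin n → OneSparse d) :
    Measure (EuclideanSpace ℝ (Fin d)) :=
  (Measure.pi fun _ : Fin d => laplaceDistribution a).map
    fun z => vectorSum v + WithLp.toLp 2 z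

/-- The `ℓ₂` error of an estimate with law `μ`: its root mean square Euclidean distance to the
target. -/
def l2Error {d : ℕ} (μ : Measure (EuclideanSpace ℝ (Fin d)))
    (target : EuclideanSpace ℝ (Fin d)) : ℝ≥0∞ :=
  (∫⁻ y, ‖y - target‖ₑ ^ 2 ∂μ) ^ (1 / 2 : ℝ)

end

/-! Each user rounds its only entry, without bias, to a multiple of `2^(-T)`, sends it as one
message (a coordinate and an integer of absolute value at most `2^T`), and adds a `1/n` share of a
global noise. For each coordinate this noise has two ingredients. Geometric numbers of messages `1`
and `-1`, of ratio `q = exp(-a/2^T)`, produce discrete Laplace noise, whose variance is at most that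
of Laplace noise of parameter `a`. Poisson numbers of bundles of messages with total value zero hide
individual messages and leave the estimate unchanged. The shares exist because negative binomial and
Poisson laws are infinitely divisible.

Privacy reduces to comparing the global noise with and without one extra message. Two multiset
identities (`add_sum_merge`, `split_add_sum_cancel`) trade a message of value `±m` for at most `m`
unit messages, at the price of inserting or deleting a few zero-sum bundles. Unit messages are
absorbed by the geometric noise at a factor at most `exp a`. One bundle more or less changes a
Poisson number of large mean by a factor `exp e`, except on tails of mass `exp(-L)`. This is
`dominated_noise`. Replacing an input is one deletion and one insertion, hence about `2a` in total.

A bundle made of `m` and `m` opposite units, for every `m ≤ 2^T`, would need of order `4^T`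
messages. Large values are therefore first split into powers of two, and only powers of two are
merged with units: the total size is then of order `T * 2^T`.

With `2^T` of order `√n (1+E)/ζ`, the rounding variance fits into the gap between the Laplace
parameters `(1-ζ/2)ε/2` and `(1-ζ)ε/2`. The noise messages, about `d * 2^T * log(1/δ)` up to
polynomial factors, are shared by `n` users, which gives `d log(1/δ)/√n` per user. -/

/-! ### Independent sums of discrete distributions -/

namespace PMF

variable {α β M N : Type*} [AddCommMonoid M] [AddCommMonoid N]

/-- The law of the sum of two independent variables, as a commutative monoid structure. -/
noncomputable instance instCommMonoidPMF : CommMonoid (PMF M) where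
  mul p q := p.bind fun s => q.map fun t => s + t
  one := PMF.pure 0
  mul_assoc p q r := by
    change (p.bind fun s => q.map fun t => s + t).bind (fun s => r.map fun t => s + t) =
      p.bind fun s => (q.bind fun s => r.map fun t => s + t).map fun t => s + t
    simp only [bind_bind, bind_map, map_bind, map_comp, Function.comp_def, add_assoc]
  one_mul p := by
    change (PMF.pure 0).bind (fun s => p.map fun t => s + t) = p
    simp only [pure_bind, zero_add]
    exact p.map_id
  mul_one p := by
    change p.bind (fun s => (PMF.pure 0).map fun t => s + t) = p
    simp [pure_map]
  mul_comm p q := by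
    change (p.bind fun s => q.map fun t => s + t) = q.bind fun s => p.map fun t => s + t
    simp only [← bind_pure_comp]
    rw [bind_comm]
    simp [Function.comp_def, add_comm]

theorem mul_def (p q : PMF M) : p * q = p.bind fun s => q.map fun t => s + t := rfl

theorem one_def : (1 : PMF M) = PMF.pure 0 := rfl

theorem pure_mul (s : M) (p : PMF M) : PMF.pure s * p = p.map fun t => s + t := by
  rw [mul_def, pure_bind]

theorem pure_mul_pure (s t : M) : PMF.pure s * PMF.pure t = PMF.pure (s + t) := by
  rw [pure_mul, pure_map]

theorem bind_mul (p : PMF α) (f : α → PMF M) (q : PMF M) :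
    p.bind f * q = p.bind fun a => f a * q := by
  simp only [mul_def, bind_bind]

theorem map_mul (f : M →+ N) (p q : PMF M) : (p * q).map f = p.map f * q.map f := by
  simp only [mul_def, map_bind, bind_map, map_comp, Function.comp_def, map_add]

/-- Push-forward along an additive homomorphism, as a homomorphism for independent sums. -/
noncomputable def mapHom (f : M →+ N) : PMF M →* PMF N where
  toFun p := p.map f
  map_one' := by rw [one_def, pure_map, map_zero, one_def]
  map_mul' := map_mul f

@[simp]
theorem mapHom_apply (f : M →+ N) (p : PMF M) : mapHom f p = p.map f := rfl

theorem tsum_bind_mul (p : PMF α) (f : α → PMF β) (g : β → ℝ≥0∞) :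
    ∑' b, p.bind f b * g b = ∑' a, p a * ∑' b, f a b * g b := by
  simp only [bind_apply, ← ENNReal.tsum_mul_right, ← ENNReal.tsum_mul_left]
  rw [ENNReal.tsum_comm]
  simp only [mul_assoc]

theorem tsum_pure_mul (a : α) (g : α → ℝ≥0∞) : ∑' b, PMF.pure a b * g b = g a := by
  rw [tsum_eq_single a fun b hb => by simp [pure_apply, hb]]
  simp

theorem tsum_map_mul (p : PMF α) (f : α → β) (g : β → ℝ≥0∞) :
    ∑' b, p.map f b * g b = ∑' a, p a * g (f a) := by
  simp only [← bind_pure_comp, tsum_bind_mul, Function.comp_def, tsum_pure_mul]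

theorem tsum_mul_mul (p q : PMF M) (g : M → ℝ≥0∞) :
    ∑' b, (p * q) b * g b = ∑' a, p a * ∑' b, q b * g (a + b) := by
  simp only [mul_def, tsum_bind_mul, tsum_map_mul]

/-- The mean of an extended nonnegative function. -/
noncomputable def mean (p : PMF α) (g : α → ℝ≥0∞) : ℝ≥0∞ := ∑' a, p a * g a

theorem mean_map (p : PMF α) (f : α → β) (g : β → ℝ≥0∞) :
    (p.map f).mean g = p.mean (g ∘ f) := tsum_map_mul p f g

theorem mean_mul (p q : PMF M) (g : M → ℝ≥0∞) (hg : ∀ a b, g (a + b) = g a + g b) :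
    (p * q).mean g = p.mean g + q.mean g := by
  simp only [mean, tsum_mul_mul, hg, mul_add, ENNReal.tsum_add, ENNReal.tsum_mul_right,
    tsum_coe, one_mul]

theorem mean_prod {ι : Type*} (s : Finset ι) (p : ι → PMF M) (g : M → ℝ≥0∞) (h0 : g 0 = 0)
    (hg : ∀ a b, g (a + b) = g a + g b) :
    (∏ i ∈ s, p i).mean g = ∑ i ∈ s, (p i).mean g := by
  classical
  induction s using Finset.induction_on with
  | empty => simp [mean, one_def, h0]
  | insert i s hi ih => rw [Finset.prod_insert hi, Finset.sum_insert hi, mean_mul _ _ _ hg, ih]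

end PMF

/-! ### Approximate domination -/

/-- `p` is bounded by `c` times `q` up to an additive slack of total mass `δ`. -/
def Dominated {α : Type*} (c δ : ℝ≥0∞) (p q : PMF α) : Prop :=
  ∃ r : α → ℝ≥0∞, ∑' a, r a ≤ δ ∧ ∀ a, p a ≤ c * q a + r a

namespace Dominated

variable {α β M : Type*} [AddCommMonoid M] {c c' δ δ' : ℝ≥0∞} {p q s : PMF α}

theorem of_le (h : ∀ a, p a ≤ c * q a) : Dominated c 0 p q :=
  ⟨0, by simp, by simpa using h⟩

theorem mono (h : Dominated c δ p q) (hc : c ≤ c') (hδ : δ ≤ δ') : Dominated c' δ' p q := by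
  obtain ⟨r, hr, hpq⟩ := h
  exact ⟨r, hr.trans hδ, fun a => (hpq a).trans (by gcongr)⟩

/-- Markov's inequality: the outcomes without a pointwise bound carry mass at most the mean of `g`.
With an exponential `g` this is a Chernoff bound. -/
theorem of_mean_le (g : α → ℝ≥0∞) (h : ∀ a, p a ≤ c * q a ∨ 1 ≤ g a) (hg : p.mean g ≤ δ) :
    Dominated c δ p q := by
  refine ⟨fun a => p a * g a, hg, fun a => ?_⟩
  rcases h a with h | h
  · exact h.trans le_self_add
  · exact (le_mul_of_one_le_right' h).trans le_add_self

theorem refl (p : PMF α) : Dominated 1 0 p p := of_le fun a => by simp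

theorem trans (h : Dominated c δ p q) (h' : Dominated c' δ' q s) :
    Dominated (c * c') (δ + c * δ') p s := by
  obtain ⟨r, hr, hpq⟩ := h
  obtain ⟨r', hr', hqs⟩ := h'
  refine ⟨fun a => r a + c * r' a, ?_, fun a => ?_⟩
  · rw [ENNReal.tsum_add, ENNReal.tsum_mul_left]
    gcongr
  · calc p a ≤ c * q a + r a := hpq a
      _ ≤ c * (c' * s a + r' a) + r a := by gcongr; exact hqs a
      _ = c * c' * s a + (r a + c * r' a) := by ring

theorem toOuterMeasure_le (h : Dominated c δ p q) (S : Set α) :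
    p.toOuterMeasure S ≤ c * q.toOuterMeasure S + δ := by
  obtain ⟨r, hr, hpq⟩ := h
  rw [PMF.toOuterMeasure_apply, PMF.toOuterMeasure_apply, ← ENNReal.tsum_mul_left]
  refine le_trans ?_ (add_le_add le_rfl hr)
  rw [← ENNReal.tsum_add]
  refine ENNReal.tsum_le_tsum fun a => ?_
  by_cases ha : a ∈ S
  · simpa [ha] using hpq a
  · simp [ha]

theorem bind (h : Dominated c δ p q) (f : α → PMF β) : Dominated c δ (p.bind f) (q.bind f) := by
  obtain ⟨r, hr, hpq⟩ := h
  refine ⟨fun b => ∑' a, r a * f a b, ?_, fun b => ?_⟩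
  · rw [ENNReal.tsum_comm]
    simpa [ENNReal.tsum_mul_left] using hr
  · rw [PMF.bind_apply, PMF.bind_apply, ← ENNReal.tsum_mul_left, ← ENNReal.tsum_add]
    refine ENNReal.tsum_le_tsum fun a => ?_
    calc p a * f a b ≤ (c * q a + r a) * f a b := by gcongr; exact hpq a
      _ = c * (q a * f a b) + r a * f a b := by ring

theorem map (h : Dominated c δ p q) (f : α → β) : Dominated c δ (p.map f) (q.map f) :=
  h.bind _

theorem bind_congr (p : PMF α) {f g : α → PMF β} (h : ∀ a, Dominated c δ (f a) (g a)) :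
    Dominated c δ (p.bind f) (p.bind g) := by
  choose r hr hfg using h
  refine ⟨fun b => ∑' a, p a * r a b, ?_, fun b => ?_⟩
  · rw [ENNReal.tsum_comm]
    simp only [ENNReal.tsum_mul_left]
    calc ∑' a, p a * ∑' b, r a b ≤ ∑' a, p a * δ := by gcongr; exact hr _
      _ = δ := by rw [ENNReal.tsum_mul_right, p.tsum_coe, one_mul]
  · rw [PMF.bind_apply, PMF.bind_apply, ← ENNReal.tsum_mul_left, ← ENNReal.tsum_add]
    refine ENNReal.tsum_le_tsum fun a => ?_
    calc p a * f a b ≤ p a * (c * g a b + r a b) := by gcongr; exact hfg a b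
      _ = c * (p a * g a b) + p a * r a b := by ring

theorem bind_left (p : PMF α) {f : α → PMF β} {q : PMF β} (h : ∀ a, Dominated c δ (f a) q) :
    Dominated c δ (p.bind f) q := by
  simpa using bind_congr p (g := fun _ => q) h

theorem bind_right (p : PMF α) {f : α → PMF β} {q : PMF β} (h : ∀ a, Dominated c δ q (f a)) :
    Dominated c δ q (p.bind f) := by
  simpa using bind_congr p (f := fun _ => q) h

/-- Adding independent noise is post-processing, so a comparison may act on one factor of a product
of laws and leave the others alone. -/
theorem mul_left {p q : PMF M} (h : Dominated c δ p q) (s : PMF M) :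
    Dominated c δ (s * p) (s * q) :=
  bind_congr s fun a => h.map fun t => a + t

/-- Adding finitely many elements, each of which can be added at a fixed cost. -/
theorem pure_sum_mul {ι : Type*} {ν : PMF M} (hc : 1 ≤ c) (w : ι → M) (I : Finset ι)
    (h : ∀ i ∈ I, Dominated c δ (PMF.pure (w i) * ν) ν) :
    Dominated (c ^ I.card) (I.card * c ^ I.card * δ) (PMF.pure (∑ i ∈ I, w i) * ν) ν := by
  classical
  induction I using Finset.induction_on with
  | empty => simpa [← PMF.one_def] using refl ν
  | insert i I hi ih =>
    rw [Finset.sum_insert hi, ← PMF.pure_mul_pure, mul_assoc (PMF.pure (w i)), Finset.card_insert_of_notMem hi]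
    have h1 := ih fun j hj => h j (Finset.mem_insert_of_mem hj)
    have h2 := h i (Finset.mem_insert_self i I)
    refine ((h1.mul_left (PMF.pure (w i))).trans h2).mono ((pow_succ _ _).ge) ?_
    calc I.card * c ^ I.card * δ + c ^ I.card * δ = (I.card + 1) * c ^ I.card * δ := by ring
      _ ≤ (I.card + 1 : ℕ) * c ^ (I.card + 1) * δ := by
        push_cast
        gcongr
        omega

/-- Removing finitely many elements, each of which can be removed at a fixed cost. -/
theorem le_pure_sum_mul {ι : Type*} {ν : PMF M} (hc : 1 ≤ c) (w : ι → M) (I : Finset ι)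
    (h : ∀ i ∈ I, Dominated c δ ν (PMF.pure (w i) * ν)) :
    Dominated (c ^ I.card) (I.card * c ^ I.card * δ) ν (PMF.pure (∑ i ∈ I, w i) * ν) := by
  classical
  induction I using Finset.induction_on with
  | empty => simpa [← PMF.one_def] using refl ν
  | insert i I hi ih =>
    rw [Finset.sum_insert hi, ← PMF.pure_mul_pure, mul_assoc (PMF.pure (w i)), Finset.card_insert_of_notMem hi]
    have h1 := ih fun j hj => h j (Finset.mem_insert_of_mem hj)
    have h2 := h i (Finset.mem_insert_self i I)
    refine (h2.trans (h1.mul_left (PMF.pure (w i)))).mono ((pow_succ' _ _).ge) ?_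
    calc δ + c * (I.card * c ^ I.card * δ) ≤ c ^ (I.card + 1) * δ + c * (I.card * c ^ I.card * δ) := by
          gcongr
          exact le_mul_of_one_le_left' (one_le_pow₀ hc)
      _ = (I.card + 1 : ℕ) * c ^ (I.card + 1) * δ := by push_cast; ring

end Dominated

/-! ### Infinitely divisible distributions on the natural numbers -/

namespace PMF

open scoped NNReal
open Finset.HasAntidiagonal (antidiagonal)

theorem mul_apply_nat (p q : PMF ℕ) (k : ℕ) :
    (p * q) k = ∑ x ∈ antidiagonal k, p x.1 * q x.2 := by
  classical
  have h := tsum_mul_mul p q fun b => if b = k then 1 else 0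
  simp only [mul_ite, mul_one, mul_zero, tsum_ite_eq] at h
  rw [h]
  simp only [← ENNReal.tsum_mul_left]
  rw [← ENNReal.tsum_prod (f := fun a b => p a * if a + b = k then q b else 0),
    tsum_eq_sum (s := antidiagonal k)]
  · refine Finset.sum_congr rfl fun x hx => ?_
    rw [if_pos (Finset.HasAntidiagonal.mem_antidiagonal.mp hx)]
  · intro x hx
    rw [if_neg (by simpa using hx), mul_zero]

theorem map_add_left_apply (p : PMF ℕ) (m k : ℕ) :
    p.map (fun t => m + t) k = if m ≤ k then p (k - m) else 0 := by
  rw [map_apply]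
  split_ifs with h
  · rw [tsum_eq_single (k - m), if_pos (by omega)]
    exact fun b hb => if_neg (by omega)
  · exact ENNReal.tsum_eq_zero.mpr fun a => if_neg (by omega)

/-- The distribution on `ℕ` with given real point masses. -/
noncomputable def ofRealMass (f : ℕ → ℝ) (h0 : ∀ k, 0 ≤ f k) (h1 : HasSum f 1) : PMF ℕ :=
  ⟨fun k => ENNReal.ofReal (f k), by
    have := ENNReal.summable.hasSum (f := fun k => ENNReal.ofReal (f k))
    rwa [← ENNReal.ofReal_tsum_of_nonneg h0 h1.summable, h1.tsum_eq, ENNReal.ofReal_one] at this⟩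

/-- The Poisson distribution. -/
noncomputable def poisson (l : ℝ≥0) : PMF ℕ :=
  ofRealMass (fun k => Real.exp (-l) * l ^ k / k.factorial) (fun k => by positivity)
    (ProbabilityTheory.hasSum_one_poissonMeasure l)

theorem poisson_apply (l : ℝ≥0) (k : ℕ) :
    poisson l k = ENNReal.ofReal (Real.exp (-l) * l ^ k / k.factorial) := rfl

theorem poisson_mul_poisson (l m : ℝ≥0) : poisson l * poisson m = poisson (l + m) := by
  ext k
  rw [mul_apply_nat]
  simp only [poisson_apply]
  rw [Finset.sum_congr rfl fun x _ => (ENNReal.ofReal_mul (by positivity)).symm,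
    ← ENNReal.ofReal_sum_of_nonneg fun x _ => by positivity]
  congr 1
  push_cast
  rw [Finset.Nat.sum_antidiagonal_eq_sum_range_succ_mk, add_pow, Finset.mul_sum,
    Finset.sum_div]
  refine Finset.sum_congr rfl fun i hi => ?_
  have hi : i ≤ k := by simpa [Nat.lt_succ_iff] using hi
  rw [Nat.cast_choose ℝ hi, neg_add, Real.exp_add]
  field_simp

theorem poisson_zero : poisson 0 = 1 := by
  ext k
  rw [poisson_apply, one_def, pure_apply]
  rcases k with _ | k <;> simp

theorem poisson_pow (l : ℝ≥0) (n : ℕ) : poisson l ^ n = poisson (n * l) := by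
  induction n with
  | zero => simp [poisson_zero]
  | succ n ih => rw [pow_succ, ih, poisson_mul_poisson]; congr 1; push_cast; ring

/-- Exponential tilting of the Poisson distribution. -/
theorem poisson_mul_exp (l : ℝ≥0) (t : ℝ) (k : ℕ) :
    poisson l k * ENNReal.ofReal (Real.exp (t * k)) =
      ENNReal.ofReal (Real.exp (l * (Real.exp t - 1))) *
        poisson (l * (Real.exp t).toNNReal) k := by
  rw [poisson_apply, poisson_apply, ← ENNReal.ofReal_mul (by positivity),
    ← ENNReal.ofReal_mul (by positivity)]
  congr 1
  have h1 : Real.exp (t * k) = Real.exp t ^ k := by rw [← Real.exp_nat_mul, mul_comm]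
  have h2 : Real.exp (l * (Real.exp t - 1)) =
      Real.exp (l * Real.exp t) * Real.exp (-l) := by rw [← Real.exp_add]; ring_nf
  push_cast
  rw [Real.coe_toNNReal _ (Real.exp_pos t).le, h1, h2, Real.exp_neg (l * Real.exp t), mul_pow]
  field_simp

theorem poisson_mean_exp (l : ℝ≥0) (t s : ℝ) :
    (poisson l).mean (fun k => ENNReal.ofReal (Real.exp (t * k + s))) =
      ENNReal.ofReal (Real.exp (l * (Real.exp t - 1) + s)) := by
  simp only [mean, Real.exp_add]
  simp_rw [ENNReal.ofReal_mul (Real.exp_pos _).le, ← mul_assoc, poisson_mul_exp]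
  rw [ENNReal.tsum_mul_right, ENNReal.tsum_mul_left, tsum_coe, mul_one]

theorem poisson_mean_cast (l : ℝ≥0) : (poisson l).mean (fun k => (k : ℝ≥0∞)) = l := by
  have h : ∀ k, poisson l (k + 1) * ((k + 1 : ℕ) : ℝ≥0∞) = l * poisson l k := by
    intro k
    rw [poisson_apply, poisson_apply, ← ENNReal.ofReal_natCast, ← ENNReal.ofReal_coe_nnreal,
      ← ENNReal.ofReal_mul (by positivity), ← ENNReal.ofReal_mul (by positivity)]
    congr 1
    rw [Nat.factorial_succ]
    push_cast
    rw [pow_succ]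
    field_simp
  rw [mean, tsum_eq_zero_add']
  · simp only [h, ENNReal.tsum_mul_left, tsum_coe]
    simp
  · exact ENNReal.summable

/-- The ratio of the shifted mass to the original mass at `k` is `k / l`, which is at most `exp e`
outside the upper tail `k > exp e * l`. -/
theorem poisson_succ_dominated {l : ℝ≥0} {e L : ℝ} (he : 0 < e) (he1 : e ≤ 1)
    (hl : 8 * (1 + L) / e ^ 2 ≤ l) :
    Dominated (ENNReal.ofReal (Real.exp e)) (ENNReal.ofReal (Real.exp (-L)))
      ((poisson l).map fun t => 1 + t) (poisson l) := by
  have hl' : 8 * (1 + L) ≤ l * e ^ 2 := by rwa [div_le_iff₀ (by positivity)] at hl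
  have hexp : 1 + e ≤ Real.exp e := by linarith [Real.add_one_le_exp e]
  refine Dominated.of_mean_le
    -- Chernoff weight of exponent `e / 2`, normalized to reach `1` at the threshold `exp e * l`.
    (fun k => ENNReal.ofReal (Real.exp (e / 2 * k + -(e / 2 * (Real.exp e * l))))) ?_ ?_
  · intro k
    rw [map_add_left_apply]
    by_cases hk : (k : ℝ) ≤ Real.exp e * l
    · left
      rcases k with _ | k
      · simp
      · rw [if_pos (by omega), Nat.add_sub_cancel, poisson_apply, poisson_apply,
          ← ENNReal.ofReal_mul (by positivity)]
        apply ENNReal.ofReal_le_ofReal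
        rw [Nat.factorial_succ, pow_succ]
        push_cast at hk ⊢
        have : Real.exp e * (Real.exp (-l) * (l ^ k * l) / ((k + 1) * k.factorial)) =
          (Real.exp (-l) * l ^ k / k.factorial) * ((Real.exp e * l) / (k + 1)) := by
            field_simp
        rw [this]
        refine le_mul_of_one_le_right (by positivity) ?_
        rwa [one_le_div (by positivity)]
    · right
      rw [ENNReal.one_le_ofReal, Real.one_le_exp_iff]
      nlinarith
  · have : ∀ k : ℕ, e / 2 * ((1 + k : ℕ) : ℝ) + -(e / 2 * (Real.exp e * l)) =
        e / 2 * k + (e / 2 + -(e / 2 * (Real.exp e * l))) := by intro k; push_cast; ring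
    rw [mean_map]
    simp only [Function.comp_def, this]
    rw [poisson_mean_exp]
    apply ENNReal.ofReal_le_ofReal
    rw [Real.exp_le_exp]
    have h2 : Real.exp (e / 2) ≤ 1 + e / 2 + (e / 2) ^ 2 := by
      have := Real.abs_exp_sub_one_sub_id_le (x := e / 2) (by rw [abs_of_pos] <;> linarith)
      linarith [(abs_le.mp this).2]
    have hl0 : (0 : ℝ) ≤ l := l.coe_nonneg
    have h3 : l * (Real.exp (e / 2) - 1) ≤ l * (e / 2 + (e / 2) ^ 2) := by gcongr; linarith
    have h4 : e / 2 * ((1 + e) * l) ≤ e / 2 * (Real.exp e * l) := by gcongr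
    have h5 : l * (e / 2 + (e / 2) ^ 2) - e / 2 * ((1 + e) * l) = -(l * e ^ 2) / 4 := by ring
    have h6 : 0 ≤ l * e ^ 2 := by positivity
    linarith

/-- Here the ratio is `l / k`, and the exceptional set is the lower tail `k ≤ exp (-e) * l`. Its
Chernoff exponent `-(l * e ^ 2) / 8` accounts for the constant `8` in the hypothesis. -/
theorem dominated_poisson_succ {l : ℝ≥0} {e L : ℝ} (he : 0 < e) (he1 : e ≤ 1)
    (hl : 8 * (1 + L) / e ^ 2 ≤ l) :
    Dominated (ENNReal.ofReal (Real.exp e)) (ENNReal.ofReal (Real.exp (-L)))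
      (poisson l) ((poisson l).map fun t => 1 + t) := by
  have hl' : 8 * (1 + L) ≤ l * e ^ 2 := by rwa [div_le_iff₀ (by positivity)] at hl
  refine Dominated.of_mean_le
    (fun k => ENNReal.ofReal (Real.exp (-(e / 2) * k + e / 2 * (Real.exp (-e) * l)))) ?_ ?_
  · intro k
    rw [map_add_left_apply]
    by_cases hk : (k : ℝ) ≤ Real.exp (-e) * l
    · right
      rw [ENNReal.one_le_ofReal, Real.one_le_exp_iff]
      nlinarith
    · left
      rcases k with _ | k
      -- The shifted law has no mass at `0`, but `0` always lies in the exceptional tail.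
      · exact absurd (by push_cast; positivity) hk
      · rw [if_pos (by omega), Nat.add_sub_cancel, poisson_apply, poisson_apply,
          ← ENNReal.ofReal_mul (by positivity)]
        apply ENNReal.ofReal_le_ofReal
        rw [Nat.factorial_succ, pow_succ]
        push_cast at hk ⊢
        have : Real.exp (-l) * (l ^ k * l) / ((k + 1) * k.factorial) =
          Real.exp e * (Real.exp (-l) * l ^ k / k.factorial) *
            ((Real.exp (-e) * l) / (k + 1)) := by
            rw [Real.exp_neg e]
            field_simp
        rw [this]
        refine mul_le_of_le_one_right (by positivity) ?_
        rw [div_le_one (by positivity)]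
        linarith
  · rw [poisson_mean_exp]
    apply ENNReal.ofReal_le_ofReal
    rw [Real.exp_le_exp]
    have key : ∀ x : ℝ, 0 ≤ x → x ≤ 1 → Real.exp (-x) ≤ 1 - x + x ^ 2 / 2 := by
      intro x hx hx1
      have h := Real.exp_bound' (x := x) hx hx1 (n := 1) one_pos
      have := Real.quadratic_le_exp_of_nonneg hx
      rw [Real.exp_neg, inv_le_comm₀ (Real.exp_pos _) (by nlinarith)]
      refine le_trans ?_ this
      rw [inv_le_iff_one_le_mul₀ (by nlinarith)]
      nlinarith [pow_nonneg hx 4]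
    have h2 := key (e / 2) (by linarith) (by linarith)
    have h3 := key e he.le he1
    have hl0 : (0 : ℝ) ≤ l := l.coe_nonneg
    have h4 : l * (Real.exp (-(e / 2)) - 1) ≤ l * (-(e / 2) + (e / 2) ^ 2 / 2) := by
      gcongr; linarith
    have h5 : e / 2 * (Real.exp (-e) * l) ≤ e / 2 * ((1 - e / 2) * l) := by
      gcongr; nlinarith
    have h6 : l * (-(e / 2) + (e / 2) ^ 2 / 2) + e / 2 * ((1 - e / 2) * l) =
      -(l * e ^ 2) / 8 := by ring
    linarith

end PMF

/-! ### The negative binomial distribution with a real parameter -/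

namespace PMF

open scoped NNReal
open Finset.HasAntidiagonal (antidiagonal)

/-- After multiplication by `k!`, both sides are the rising factorial `r (r + 1) ⋯ (r + k)`. -/
theorem succ_mul_multichoose_succ (r : ℝ) (k : ℕ) :
    (k + 1) * Ring.multichoose r (k + 1) = r * Ring.multichoose (r + 1) k := by
  have h1 := Ring.factorial_nsmul_multichoose_eq_ascPochhammer r (k + 1)
  have h2 := Ring.factorial_nsmul_multichoose_eq_ascPochhammer (r + 1) k
  have h0 : (k.factorial : ℝ) ≠ 0 := by positivity
  rw [Polynomial.ascPochhammer_smeval_eq_eval, nsmul_eq_mul] at h1 h2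
  rw [ascPochhammer_succ_left, Nat.factorial_succ] at h1
  simp only [Polynomial.eval_mul, Polynomial.eval_comp, Polynomial.eval_X, Polynomial.eval_add,
    Polynomial.eval_one] at h1
  rw [← h2] at h1
  push_cast at h1
  apply mul_left_cancel₀ h0
  linarith

theorem multichoose_nonneg {r : ℝ} (hr : 0 ≤ r) (k : ℕ) : 0 ≤ Ring.multichoose r k := by
  induction k generalizing r with
  | zero => simp
  | succ k ih =>
    have h := succ_mul_multichoose_succ r k
    have h' : 0 ≤ r * Ring.multichoose (r + 1) k := mul_nonneg hr (ih (by linarith))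
    rw [← h] at h'
    exact nonneg_of_mul_nonneg_right h' (by positivity)

/-- Vandermonde's identity at `-r` and `-s`, where all terms carry the same sign `(-1)^k`. It makes
the negative binomial laws a convolution semigroup in `r`. -/
theorem multichoose_add (r s : ℝ) (k : ℕ) :
    Ring.multichoose (r + s) k =
      ∑ x ∈ antidiagonal k, Ring.multichoose r x.1 * Ring.multichoose s x.2 := by
  have h := Ring.add_choose_eq (r := -r) (s := -s) k (Commute.all _ _)
  rw [← neg_add, Ring.choose_neg'] at h
  have h2 : ∀ x ∈ antidiagonal k, Ring.choose (-r) x.1 * Ring.choose (-s) x.2 =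
      Int.negOnePow k • (Ring.multichoose r x.1 * Ring.multichoose s x.2) := by
    intro x hx
    rw [Ring.choose_neg', Ring.choose_neg', smul_mul_smul_comm, ← Int.negOnePow_add]
    congr 2
    exact_mod_cast Finset.HasAntidiagonal.mem_antidiagonal.mp hx
  rw [Finset.sum_congr rfl h2, ← Finset.smul_sum] at h
  exact smul_left_cancel _ h

theorem hasSum_multichoose (r : ℝ) {q : ℝ} (hq0 : 0 ≤ q) (hq1 : q < 1) :
    HasSum (fun k => Ring.multichoose r k * q ^ k) ((1 - q) ^ (-r)) := by
  have h := (Real.one_div_one_sub_rpow_hasFPowerSeriesOnBall_zero r).hasSum (y := q) (by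
    simpa [enorm_eq_nnnorm, ← NNReal.coe_lt_one, abs_of_nonneg hq0] using hq1)
  simp only [FormalMultilinearSeries.ofScalars_apply_eq, zero_add, smul_eq_mul,
    ← Ring.multichoose_eq] at h
  rwa [one_div, ← Real.rpow_neg (by linarith)] at h

/-- The mass function of the negative binomial distribution. -/
noncomputable def negBinomialMass (q r : ℝ) (k : ℕ) : ℝ :=
  (1 - q) ^ r * (Ring.multichoose r k * q ^ k)

theorem negBinomialMass_nonneg {q r : ℝ} (hq0 : 0 ≤ q) (hq1 : q < 1) (hr : 0 ≤ r) (k : ℕ) :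
    0 ≤ negBinomialMass q r k :=
  mul_nonneg (Real.rpow_nonneg (by linarith) _)
    (mul_nonneg (multichoose_nonneg hr k) (pow_nonneg hq0 _))

theorem hasSum_negBinomialMass {q : ℝ} (hq0 : 0 ≤ q) (hq1 : q < 1) (r : ℝ) :
    HasSum (negBinomialMass q r) 1 := by
  have h := (hasSum_multichoose r hq0 hq1).mul_left ((1 - q) ^ r)
  rwa [← Real.rpow_add (by linarith), add_neg_cancel, Real.rpow_zero] at h

/-- Weighting by the variable raises `r` by one, so each moment reduces to a lower moment at `r +
1`, and finally to the total mass. -/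
theorem succ_mul_negBinomialMass_succ {q : ℝ} (hq1 : q < 1) (r : ℝ) (k : ℕ) :
    (k + 1) * negBinomialMass q r (k + 1) = r * (q / (1 - q)) * negBinomialMass q (r + 1) k := by
  have h0 : (1 - q) ≠ 0 := by linarith
  rw [negBinomialMass, negBinomialMass, Real.rpow_add (by linarith), Real.rpow_one]
  calc _ = (1 - q) ^ r * (((k + 1) * Ring.multichoose r (k + 1)) * q ^ (k + 1)) := by ring
    _ = _ := by rw [succ_mul_multichoose_succ, pow_succ]; field_simp

theorem hasSum_mul_negBinomialMass {q : ℝ} (hq0 : 0 ≤ q) (hq1 : q < 1) (r : ℝ) :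
    HasSum (fun k : ℕ => k * negBinomialMass q r k) (r * (q / (1 - q))) := by
  rw [← hasSum_nat_add_iff' 1]
  have h := (hasSum_negBinomialMass hq0 hq1 (r + 1)).mul_left (r * (q / (1 - q)))
  simp only [← succ_mul_negBinomialMass_succ hq1] at h
  simpa using h

theorem hasSum_sq_mul_negBinomialMass {q : ℝ} (hq0 : 0 ≤ q) (hq1 : q < 1) (r : ℝ) :
    HasSum (fun k : ℕ => (k : ℝ) ^ 2 * negBinomialMass q r k)
      (r * (q / (1 - q)) * ((r + 1) * (q / (1 - q)) + 1)) := by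
  rw [← hasSum_nat_add_iff' 1]
  have h := ((hasSum_mul_negBinomialMass hq0 hq1 (r + 1)).add
    (hasSum_negBinomialMass hq0 hq1 (r + 1))).mul_left (r * (q / (1 - q)))
  have h2 : ∀ k : ℕ, r * (q / (1 - q)) *
      (k * negBinomialMass q (r + 1) k + negBinomialMass q (r + 1) k) =
      ((k + 1 : ℕ) : ℝ) ^ 2 * negBinomialMass q r (k + 1) := by
    intro k
    have := succ_mul_negBinomialMass_succ hq1 r k
    push_cast
    linear_combination (-(k : ℝ) - 1) * this
  simp only [h2] at h
  simpa using h

/-- The sum of the masses against a quadratic polynomial in the centered variable. -/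
theorem hasSum_negBinomialMass_quadratic {q : ℝ} (hq0 : 0 ≤ q) (hq1 : q < 1) (r a b c : ℝ) :
    HasSum (fun k : ℕ => negBinomialMass q r k *
        (a * (k - r * (q / (1 - q))) ^ 2 + b * (k - r * (q / (1 - q))) + c))
      (a * (r * (q / (1 - q) ^ 2)) + c) := by
  have h0 : (1 - q) ≠ 0 := by linarith
  obtain ⟨m, hm⟩ : ∃ m, m = r * (q / (1 - q)) := ⟨_, rfl⟩
  have h := ((hasSum_sq_mul_negBinomialMass hq0 hq1 r).mul_left a).add
    (((hasSum_mul_negBinomialMass hq0 hq1 r).mul_left (b - 2 * a * m)).add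
      ((hasSum_negBinomialMass hq0 hq1 r).mul_left (a * m ^ 2 - b * m + c)))
  rw [← hm]
  convert! h using 1
  · ext k; ring
  · rw [hm]; field_simp; ring

/-- The negative binomial distribution: the law of the number of failures, of probability `q`
each, before the `r`-th success. -/
noncomputable def negBinomial (q : ℝ) (hq : q ∈ Set.Ico (0 : ℝ) 1) (r : ℝ≥0) : PMF ℕ :=
  ofRealMass (negBinomialMass q r) (negBinomialMass_nonneg hq.1 hq.2 r.coe_nonneg)
    (hasSum_negBinomialMass hq.1 hq.2 r)

variable {q : ℝ} (hq : q ∈ Set.Ico (0 : ℝ) 1)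

theorem negBinomial_apply (r : ℝ≥0) (k : ℕ) :
    negBinomial q hq r k = ENNReal.ofReal (negBinomialMass q r k) := rfl

theorem negBinomial_mul_negBinomial (r s : ℝ≥0) :
    negBinomial q hq r * negBinomial q hq s = negBinomial q hq (r + s) := by
  have h0 := fun r : ℝ≥0 => negBinomialMass_nonneg hq.1 hq.2 r.coe_nonneg
  ext k
  rw [mul_apply_nat]
  simp only [negBinomial_apply]
  rw [Finset.sum_congr rfl fun x _ => (ENNReal.ofReal_mul (h0 r x.1)).symm,
    ← ENNReal.ofReal_sum_of_nonneg fun x _ => mul_nonneg (h0 _ _) (h0 _ _)]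
  congr 1
  simp only [negBinomialMass]
  rw [NNReal.coe_add, multichoose_add, Real.rpow_add (by linarith [hq.2]), Finset.sum_mul,
    Finset.mul_sum]
  refine Finset.sum_congr rfl fun x hx => ?_
  rw [← Finset.HasAntidiagonal.mem_antidiagonal.mp hx, pow_add]
  ring

theorem negBinomial_zero : negBinomial q hq 0 = 1 := by
  ext k
  rw [negBinomial_apply, one_def, pure_apply]
  rcases k with _ | k <;> simp [negBinomialMass, Ring.multichoose_zero_succ]

theorem negBinomial_pow (r : ℝ≥0) (n : ℕ) :
    negBinomial q hq r ^ n = negBinomial q hq (n * r) := by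
  induction n with
  | zero => simp [negBinomial_zero]
  | succ n ih => rw [pow_succ, ih, negBinomial_mul_negBinomial]; congr 1; push_cast; ring

theorem negBinomial_one_apply (k : ℕ) :
    negBinomial q hq 1 k = ENNReal.ofReal ((1 - q) * q ^ k) := by
  simp [negBinomial_apply, negBinomialMass, Ring.multichoose_one]

theorem negBinomial_mean_cast (r : ℝ≥0) :
    (negBinomial q hq r).mean (fun k => (k : ℝ≥0∞)) = ENNReal.ofReal (r * (q / (1 - q))) := by
  have h := hasSum_mul_negBinomialMass hq.1 hq.2 r
  have h0 := negBinomialMass_nonneg hq.1 hq.2 r.coe_nonneg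
  rw [← h.tsum_eq, ENNReal.ofReal_tsum_of_nonneg
    (fun k => mul_nonneg (Nat.cast_nonneg k) (h0 k)) h.summable]
  refine tsum_congr fun k => ?_
  rw [negBinomial_apply, ENNReal.ofReal_mul (by positivity), ENNReal.ofReal_natCast, mul_comm]

/-- Shifting a geometric variable by `m ≤ t` costs a factor `q ^ (-t)`. -/
theorem negBinomial_one_add_dominated (hq0 : 0 < q) {m t : ℕ} (hm : m ≤ t) :
    Dominated (ENNReal.ofReal (q ^ t)⁻¹) 0 ((negBinomial q hq 1).map fun k => m + k)
      (negBinomial q hq 1) := by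
  refine Dominated.of_le fun k => ?_
  rw [map_add_left_apply]
  split_ifs with h
  · rw [negBinomial_one_apply, negBinomial_one_apply, ← ENNReal.ofReal_mul (by positivity)]
    apply ENNReal.ofReal_le_ofReal
    have h1 : 0 < 1 - q := by linarith [hq.2]
    rw [← div_eq_inv_mul, le_div_iff₀ (by positivity), mul_assoc, ← pow_add]
    exact mul_le_mul_of_nonneg_left (pow_le_pow_of_le_one hq0.le hq.2.le (by omega)) h1.le
  · exact zero_le
end PMF

/-! ### Means and variances of vector-valued discrete distributions -/

namespace PMF

open scoped NNReal

variable {V : Type*} [NormedAddCommGroup V]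

/-- `p` has mean `m` and variance at most `σ`, expressed through the second moments around all
points. -/
def HasVarianceLE (p : PMF V) (m : V) (σ : ℝ≥0∞) : Prop :=
  ∀ u : V, p.mean (fun x => ‖x - m + u‖ₑ ^ 2) ≤ σ + ‖u‖ₑ ^ 2

namespace HasVarianceLE

variable {p q : PMF V} {m m' : V} {σ σ' : ℝ≥0∞}

theorem pure (v : V) : HasVarianceLE (PMF.pure v) v 0 := fun u => by
  rw [mean, tsum_pure_mul]; simp

theorem mono (h : HasVarianceLE p m σ) (hσ : σ ≤ σ') : HasVarianceLE p m σ' :=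
  fun u => (h u).trans (by gcongr)

/-- Since the bound holds around every point, no cross terms arise: for a fixed first summand `x`,
the bound for `q` is used at `x - m + u`, and then the bound for `p` at `u`. -/
theorem mul (hp : HasVarianceLE p m σ) (hq : HasVarianceLE q m' σ') :
    HasVarianceLE (p * q) (m + m') (σ + σ') := fun u => by
  rw [mean, tsum_mul_mul]
  have h : ∀ x, ∑' y, q y * ‖x + y - (m + m') + u‖ₑ ^ 2 ≤ σ' + ‖x - m + u‖ₑ ^ 2 := fun x => by
    refine le_trans (le_of_eq ?_) (hq (x - m + u))
    refine tsum_congr fun y => ?_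
    rw [show x + y - (m + m') + u = y - m' + (x - m + u) by abel]
  calc ∑' x, p x * ∑' y, q y * ‖x + y - (m + m') + u‖ₑ ^ 2
      ≤ ∑' x, p x * (σ' + ‖x - m + u‖ₑ ^ 2) := by gcongr; exact h _
    _ = σ' + p.mean (fun x => ‖x - m + u‖ₑ ^ 2) := by
      simp only [mul_add, ENNReal.tsum_add, ENNReal.tsum_mul_right, tsum_coe, one_mul, mean]
    _ ≤ σ' + (σ + ‖u‖ₑ ^ 2) := by gcongr; exact hp u
    _ = σ + σ' + ‖u‖ₑ ^ 2 := by ring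

theorem prod {ι : Type*} {s : Finset ι} {p : ι → PMF V} {m : ι → V} {σ : ι → ℝ≥0∞}
    (h : ∀ i ∈ s, HasVarianceLE (p i) (m i) (σ i)) :
    HasVarianceLE (∏ i ∈ s, p i) (∑ i ∈ s, m i) (∑ i ∈ s, σ i) := by
  classical
  induction s using Finset.induction_on with
  | empty => exact pure 0
  | insert i s hi ih =>
    rw [Finset.prod_insert hi, Finset.sum_insert hi, Finset.sum_insert hi]
    exact (h i (Finset.mem_insert_self i s)).mul
      (ih fun j hj => h j (Finset.mem_insert_of_mem hj))

end HasVarianceLE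

theorem enorm_sq_eq_ofReal (x : V) : ‖x‖ₑ ^ 2 = ENNReal.ofReal (‖x‖ ^ 2) := by
  rw [← ofReal_norm, ENNReal.ofReal_pow (norm_nonneg _)]

variable [InnerProductSpace ℝ V]

theorem norm_smul_add_sq (t : ℝ) (w u : V) :
    ‖t • w + u‖ ^ 2 = ‖w‖ ^ 2 * t ^ 2 + 2 * inner ℝ w u * t + ‖u‖ ^ 2 := by
  rw [norm_add_sq_real, norm_smul, real_inner_smul_left, mul_pow, Real.norm_eq_abs, sq_abs]
  ring

/-- A negative binomial multiple of a fixed vector. -/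
theorem hasVarianceLE_negBinomial_smul {q : ℝ} (hq : q ∈ Set.Ico (0 : ℝ) 1) (r : ℝ≥0) (w : V) :
    HasVarianceLE ((negBinomial q hq r).map fun k => k • w) ((r * (q / (1 - q)) : ℝ) • w)
      (ENNReal.ofReal (‖w‖ ^ 2 * (r * (q / (1 - q) ^ 2)))) := by
  intro u
  have h0 := negBinomialMass_nonneg hq.1 hq.2 r.coe_nonneg
  have h := hasSum_negBinomialMass_quadratic hq.1 hq.2 r (‖w‖ ^ 2) (2 * inner ℝ w u) (‖u‖ ^ 2)
  have h1 : (0 : ℝ) < 1 - q := by linarith [hq.2]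
  have h2 := hq.1
  rw [mean_map, enorm_sq_eq_ofReal, ← ENNReal.ofReal_add (by positivity) (by positivity),
    ← h.tsum_eq, ENNReal.ofReal_tsum_of_nonneg _ h.summable]
  · refine le_of_eq (tsum_congr fun k => ?_)
    rw [ENNReal.ofReal_mul (h0 k), negBinomial_apply, Function.comp_apply, enorm_sq_eq_ofReal,
      ← norm_smul_add_sq, sub_smul, Nat.cast_smul_eq_nsmul]
  · intro k
    rw [← norm_smul_add_sq]
    exact mul_nonneg (h0 k) (by positivity)

/-- The law of a coin that shows `true` with probability `t`. -/
noncomputable def coin (t : ℝ≥0) (ht : t ≤ 1) : PMF Bool :=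
  ofFintype (fun b => if b then (t : ℝ≥0∞) else (1 - t : ℝ≥0)) (by
    rw [Fintype.sum_bool]
    simp only [if_true, Bool.false_eq_true, if_false]
    exact_mod_cast add_tsub_cancel_of_le ht)

theorem coin_apply (t : ℝ≥0) (ht : t ≤ 1) (b : Bool) :
    coin t ht b = if b then (t : ℝ≥0∞) else (1 - t : ℝ≥0) := rfl

/-- Unbiased randomized rounding of `(m + t) • w` to an adjacent multiple of `w`. -/
theorem hasVarianceLE_coin (t : ℝ≥0) (ht : t ≤ 1) (m : ℤ) (w : V) :
    HasVarianceLE ((coin t ht).map fun b => (if b then (m : ℝ) + 1 else m) • w)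
      ((m + t : ℝ) • w) (ENNReal.ofReal (‖w‖ ^ 2)) := by
  intro u
  have ht' : (t : ℝ) ≤ 1 := by exact_mod_cast ht
  have ht0 : (0 : ℝ) ≤ t := t.coe_nonneg
  rw [mean_map, mean, tsum_fintype, Fintype.sum_bool]
  simp only [coin_apply, Function.comp_apply, enorm_sq_eq_ofReal, if_true, Bool.false_eq_true, if_false, ← sub_smul]
  rw [← ENNReal.ofReal_coe_nnreal, ← ENNReal.ofReal_coe_nnreal, NNReal.coe_sub ht,
    ← ENNReal.ofReal_mul (by positivity), ← ENNReal.ofReal_mul (by push_cast; linarith),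
    ← ENNReal.ofReal_add (by positivity) (by push_cast; apply mul_nonneg <;> [linarith; positivity]),
    ← ENNReal.ofReal_add (by positivity) (by positivity), norm_smul_add_sq, norm_smul_add_sq]
  apply ENNReal.ofReal_le_ofReal
  push_cast
  -- The exact variance is `‖w‖ ^ 2 * t * (1 - t)`; the crude bound `t * (1 - t) ≤ 1` is enough.
  have : (0 : ℝ) ≤ ‖w‖ ^ 2 * (1 - t * (1 - t)) := by
    apply mul_nonneg (by positivity); nlinarith
  linarith

end PMF

/-! ### The view and the output of a protocol -/

namespace ShuffleProtocol

variable {X M : Type*}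

theorem collect_eq_prod {Y : Type*} (P : ShuffleProtocol X M Y) (l : List X) :
    P.collect l = (l.map P.randomizer).prod := by
  induction l with
  | nil => rfl
  | cons x l ih => rw [collect, ih, List.map_cons, List.prod_cons, PMF.mul_def]

theorem collect_ofFn {Y : Type*} (P : ShuffleProtocol X M Y) {n : ℕ} (x : Fin n → X) :
    P.collect (List.ofFn x) = ∏ i, P.randomizer (x i) := by
  rw [collect_eq_prod, List.map_ofFn, List.prod_ofFn]
  rfl

theorem shuffler_map_coe (s : Multiset M) :
    (shuffler s).map (fun l : List M => (l : Multiset M)) = PMF.pure s := by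
  rw [shuffler, PMF.map_comp]
  have h : ∀ σ : Equiv.Perm (Fin s.toList.length),
      ((List.ofFn fun i => s.toList.get (σ i) : List M) : Multiset M) = s := by
    intro σ
    conv_rhs => rw [← Multiset.coe_toList s]
    rw [Multiset.coe_eq_coe]
    conv_rhs => rw [← List.ofFn_get s.toList]
    exact Equiv.Perm.ofFn_comp_perm σ s.toList.get
  have h' : ((fun l : List M => (l : Multiset M)) ∘ fun σ : Equiv.Perm (Fin s.toList.length) =>
      List.ofFn fun i => s.toList.get (σ i)) = Function.const _ s := funext h
  rw [h', PMF.map_const]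

/-- For an analyzer that adds up the values of the messages, the output is the sum of independent
contributions of the users. -/
theorem output_eq_prod {V : Type*} [AddCommMonoid V] (P : ShuffleProtocol X M V) (f : Multiset M →+ V)
    (hf : ∀ l : List M, P.analyzer l = f l) {n : ℕ} (x : Fin n → X) :
    P.output x = ∏ i, (P.randomizer (x i)).map f := by
  have h : P.analyzer = f ∘ fun l : List M => (l : Multiset M) := funext hf
  rw [output, view, PMF.map_bind, collect_ofFn, h]
  simp only [← PMF.map_comp, shuffler_map_coe, PMF.pure_map]
  exact map_prod (PMF.mapHom f) _ _

/-- Privacy of a protocol whose users add independent noise to the encoding of their input. -/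
theorem isShuffleDP_of_dominated {Y : Type*} (P : ShuffleProtocol X M Y) (n : ℕ)
    (enc : X → PMF (Multiset M)) (η : PMF (Multiset M)) (hP : ∀ x, P.randomizer x = enc x * η)
    {c c' δ δ' : ℝ≥0∞} (h : ∀ x, Dominated c δ (enc x * η ^ n) (η ^ n))
    (h' : ∀ x, Dominated c' δ' (η ^ n) (enc x * η ^ n)) {ε₀ δ₀ : ℝ}
    (hc : c * c' ≤ ENNReal.ofReal (Real.exp ε₀)) (hδ : δ + c * δ' ≤ ENNReal.ofReal δ₀) :
    P.IsShuffleDP n ε₀ δ₀ := by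
  intro x x' ⟨i, hi⟩ S
  -- The noise shares of all users are pooled into `η ^ n`, which then protects the single user `i`.
  have key : ∀ y : Fin n → X, P.collect (List.ofFn y) =
      (∏ j ∈ Finset.univ.erase i, enc (y j)) * (enc (y i) * η ^ n) := by
    intro y
    rw [collect_ofFn, ← mul_assoc, Finset.prod_erase_mul _ _ (Finset.mem_univ i)]
    simp [hP, Finset.prod_mul_distrib]
  have hx : ∏ j ∈ Finset.univ.erase i, enc (x j) = ∏ j ∈ Finset.univ.erase i, enc (x' j) :=
    Finset.prod_congr rfl fun j hj => by rw [hi j (Finset.ne_of_mem_erase hj)]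
  -- The old input of user `i` is absorbed by the noise, then the new one is emitted from it.
  have hd := ((((h (x i)).trans (h' (x' i))).mono hc hδ).mul_left
    (∏ j ∈ Finset.univ.erase i, enc (x' j))).bind shuffler
  simp only [view]
  rw [key, key, hx]
  exact hd.toOuterMeasure_le S

end ShuffleProtocol

/-- The squared `ℓ₂` error of a discrete distribution is at most its variance. -/
theorem PMF.HasVarianceLE.l2Error_le {d : ℕ} {p : PMF (EuclideanSpace ℝ (Fin d))}
    {m : EuclideanSpace ℝ (Fin d)} {σ : ℝ≥0∞} (h : p.HasVarianceLE m σ) :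
    l2Error p.toMeasure m ≤ σ ^ (1 / 2 : ℝ) := by
  refine ENNReal.rpow_le_rpow ?_ (by norm_num)
  have h0 : p.toMeasure = Measure.sum fun x => p x • Measure.dirac x := by
    ext s hs
    rw [PMF.toMeasure_apply _ hs, Measure.sum_apply _ hs]
    refine tsum_congr fun x => ?_
    by_cases hx : x ∈ s <;> simp [hx, hs]
  rw [h0, lintegral_sum_measure]
  simp only [lintegral_smul_measure]
  refine le_trans (ENNReal.tsum_le_tsum fun x => ?_) (by simpa [PMF.mean] using h 0)
  rw [lintegral_dirac]
  simp

/-! ### Random multiples of a fixed element -/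

namespace PMF

open scoped NNReal

variable {M N : Type*} [AddCommMonoid M] [AddCommMonoid N]

/-- The law of `K • w` for a random natural number `K`. -/
noncomputable def nsmulMap (p : PMF ℕ) (w : M) : PMF M := p.map fun k => k • w

theorem nsmulMap_eq_mapHom (p : PMF ℕ) (w : M) : p.nsmulMap w = mapHom (multiplesHom M w) p := rfl

theorem nsmulMap_pow (p : PMF ℕ) (w : M) (n : ℕ) : p.nsmulMap w ^ n = (p ^ n).nsmulMap w := by
  rw [nsmulMap_eq_mapHom, nsmulMap_eq_mapHom, map_pow]

theorem nsmulMap_map (p : PMF ℕ) (w : M) (f : M →+ N) :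
    (p.nsmulMap w).map f = p.nsmulMap (f w) := by
  simp only [nsmulMap, map_comp, Function.comp_def, map_nsmul]

theorem nsmulMap_zero (p : PMF ℕ) : p.nsmulMap (0 : M) = 1 := by
  simp only [nsmulMap, smul_zero]
  exact map_const p 0

theorem pure_nsmul_mul_nsmulMap (p : PMF ℕ) (w : M) (m : ℕ) :
    PMF.pure (m • w) * p.nsmulMap w = (p.map fun k => m + k).nsmulMap w := by
  simp only [nsmulMap, pure_mul, map_comp, Function.comp_def, add_smul]

theorem mean_nsmulMap (p : PMF ℕ) (w : M) (g : M →+ ℝ≥0∞) :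
    (p.nsmulMap w).mean g = p.mean (fun k => (k : ℝ≥0∞)) * g w := by
  rw [nsmulMap, mean_map]
  simp only [mean, Function.comp_def, map_nsmul, nsmul_eq_mul, ← mul_assoc, ENNReal.tsum_mul_right]

end PMF

/-- Divisibility of laws means that `p` is the law of an independent summand of the noise `ν`;
whatever that summand can hide, `ν` can hide. -/
theorem Dominated.of_dvd {M : Type*} [AddCommMonoid M] {c δ : ℝ≥0∞} {u : M} {p ν : PMF M}
    (h : Dominated c δ (PMF.pure u * p) p) (hp : p ∣ ν) : Dominated c δ (PMF.pure u * ν) ν := by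
  obtain ⟨s, rfl⟩ := hp
  rw [← mul_assoc, mul_comm p s, mul_comm (PMF.pure u * p) s]
  exact h.mul_left s

theorem Dominated.of_dvd' {M : Type*} [AddCommMonoid M] {c δ : ℝ≥0∞} {u : M} {p ν : PMF M}
    (h : Dominated c δ p (PMF.pure u * p)) (hp : p ∣ ν) : Dominated c δ ν (PMF.pure u * ν) := by
  obtain ⟨s, rfl⟩ := hp
  rw [← mul_assoc, mul_comm p s, mul_comm (PMF.pure u * p) s]
  exact h.mul_left s

/-! ### Zero-sum bundles of messages -/

namespace ZeroSum

open scoped NNReal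
open Finset (range)

variable {M : Type*} (c : ℤ → M)

/-- The message `± a` together with the powers of two that cancel it. -/
def split (s : ℤˣ) (a : ℕ) : Multiset M :=
  {c (s * a)} + ∑ i ∈ a.bitIndices.toFinset, {c (-s * 2 ^ i)}

/-- The message `± 2 ^ i` together with the unit messages that cancel it. -/
def merge (s : ℤˣ) (i : ℕ) : Multiset M := {c (s * 2 ^ i)} + 2 ^ i • {c (-s)}

/-- `2 ^ i` pairs of opposite unit messages. -/
def cancel (s : ℤˣ) (i : ℕ) : Multiset M := 2 ^ i • ({c s} + {c (-s)})

/-- The bundles at the binary digits of `a` contribute the opposite powers of two, which complete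
`split`, and `2 ^ i` units each, which add up to `a` units. -/
theorem add_sum_merge (s : ℤˣ) (a : ℕ) :
    {c (s * a)} + ∑ i ∈ a.bitIndices.toFinset, merge c (-s) i = split c s a + a • {c s} := by
  simp only [merge, split, Finset.sum_add_distrib, ← Finset.sum_smul,
    Finset.sum_toFinset_bitIndices_two_pow, Units.val_neg, neg_neg, add_assoc]

/-- The pairs supply `a` units of each sign. This turns the removal of `a` units, which geometric
noise cannot afford, into the absorption of `a` units of the opposite sign. -/
theorem split_add_sum_cancel (s : ℤˣ) (a : ℕ) :
    split c s a + ∑ i ∈ a.bitIndices.toFinset, cancel c s i =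
      {c (s * a)} + (∑ i ∈ a.bitIndices.toFinset, merge c (-s) i + a • {c (-s)}) := by
  rw [← add_assoc, add_sum_merge]
  simp only [cancel, smul_add, Finset.sum_add_distrib, ← Finset.sum_smul,
    Finset.sum_toFinset_bitIndices_two_pow, add_assoc]

theorem mem_range_of_mem_bitIndices {T a i : ℕ} (ha : a ≤ 2 ^ T)
    (hi : i ∈ a.bitIndices.toFinset) : i ∈ range (T + 1) := by
  rw [List.mem_toFinset] at hi
  have h := (Nat.two_pow_le_of_mem_bitIndices hi).trans ha
  have := (Nat.pow_le_pow_iff_right one_lt_two).mp h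
  exact Finset.mem_range.mpr (by omega)

theorem card_bitIndices_le {T a : ℕ} (ha : a ≤ 2 ^ T) : a.bitIndices.toFinset.card ≤ T + 1 := by
  simpa using Finset.card_le_card fun i hi => mem_range_of_mem_bitIndices (T := T) ha hi

theorem card_split_le {T a : ℕ} (ha : a ≤ 2 ^ T) (s : ℤˣ) : (split c s a).card ≤ T + 2 := by
  have := card_bitIndices_le ha
  simp only [split, Multiset.card_add, Multiset.card_singleton, Multiset.card_sum, Finset.sum_const,
    smul_eq_mul, mul_one]
  omega

theorem card_merge (s : ℤˣ) (i : ℕ) : (merge c s i).card = 1 + 2 ^ i := by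
  simp [merge, add_comm]

theorem card_cancel (s : ℤˣ) (i : ℕ) : (cancel c s i).card = 2 ^ i * 2 := by
  simp [cancel]

/-- A Poisson number of copies of a bundle. -/
noncomputable def flood (l : ℝ≥0) (w : Multiset M) : PMF (Multiset M) := (PMF.poisson l).nsmulMap w

/-- The noise for one coordinate: geometric numbers of messages `1` and `-1`, and Poisson numbers of
all zero-sum bundles of size up to `2 ^ T`. For fractional parameters, a share of the noise. -/
noncomputable def noise (T : ℕ) (q : ℝ) (hq : q ∈ Set.Ico (0 : ℝ) 1) (l r : ℝ≥0) :
    PMF (Multiset M) :=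
  ∏ s : ℤˣ, ((PMF.negBinomial q hq r).nsmulMap {c s} *
    ((∏ a ∈ range (2 ^ T + 1), flood l (split c s a)) *
      ∏ i ∈ range (T + 1), flood l (merge c s i) * flood l (cancel c s i)))

variable {T : ℕ} {q : ℝ} {hq : q ∈ Set.Ico (0 : ℝ) 1} {l r : ℝ≥0}

theorem flood_pow (l : ℝ≥0) (w : Multiset M) (n : ℕ) : flood l w ^ n = flood (n * l) w := by
  rw [flood, PMF.nsmulMap_pow, PMF.poisson_pow, flood]

theorem noise_pow (n : ℕ) : noise c T q hq l r ^ n = noise c T q hq (n * l) (n * r) := by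
  simp only [noise, ← Finset.prod_pow, mul_pow, flood_pow, PMF.nsmulMap_pow, PMF.negBinomial_pow]

theorem negBinomial_dvd_noise (s : ℤˣ) :
    (PMF.negBinomial q hq r).nsmulMap {c s} ∣ noise c T q hq l r :=
  (Dvd.intro _ rfl).trans (Finset.dvd_prod_of_mem _ (Finset.mem_univ s))

theorem flood_split_dvd_noise (s : ℤˣ) {a : ℕ} (ha : a ≤ 2 ^ T) :
    flood l (split c s a) ∣ noise c T q hq l r := by
  refine Dvd.dvd.trans ?_ (Finset.dvd_prod_of_mem _ (Finset.mem_univ s))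
  refine dvd_mul_of_dvd_right (dvd_mul_of_dvd_left ?_ _) _
  exact Finset.dvd_prod_of_mem (fun a => flood l (split c s a)) (Finset.mem_range.mpr (by omega))

theorem flood_merge_mul_flood_cancel_dvd_noise (s : ℤˣ) {i : ℕ} (hi : i ∈ range (T + 1)) :
    flood l (merge c s i) * flood l (cancel c s i) ∣ noise c T q hq l r := by
  refine Dvd.dvd.trans ?_ (Finset.dvd_prod_of_mem _ (Finset.mem_univ s))
  refine dvd_mul_of_dvd_right (dvd_mul_of_dvd_right ?_ _) _
  exact Finset.dvd_prod_of_mem (fun i => flood l (merge c s i) * flood l (cancel c s i)) hi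

theorem flood_merge_dvd_noise (s : ℤˣ) {i : ℕ} (hi : i ∈ range (T + 1)) :
    flood l (merge c s i) ∣ noise c T q hq l r :=
  (Dvd.intro _ rfl).trans (flood_merge_mul_flood_cancel_dvd_noise c s hi)

theorem flood_cancel_dvd_noise (s : ℤˣ) {i : ℕ} (hi : i ∈ range (T + 1)) :
    flood l (cancel c s i) ∣ noise c T q hq l r :=
  (Dvd.intro_left _ rfl).trans (flood_merge_mul_flood_cancel_dvd_noise c s hi)

section Privacy

variable {e L : ℝ}

theorem flood_absorb (he : 0 < e) (he1 : e ≤ 1) (hl : 8 * (1 + L) / e ^ 2 ≤ l) (w : Multiset M) :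
    Dominated (ENNReal.ofReal (Real.exp e)) (ENNReal.ofReal (Real.exp (-L)))
      (PMF.pure w * flood l w) (flood l w) := by
  have h := PMF.pure_nsmul_mul_nsmulMap (PMF.poisson l) w 1
  rw [one_smul] at h
  rw [flood, h]
  exact (PMF.poisson_succ_dominated he he1 hl).map _

theorem flood_emit (he : 0 < e) (he1 : e ≤ 1) (hl : 8 * (1 + L) / e ^ 2 ≤ l) (w : Multiset M) :
    Dominated (ENNReal.ofReal (Real.exp e)) (ENNReal.ofReal (Real.exp (-L)))
      (flood l w) (PMF.pure w * flood l w) := by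
  have h := PMF.pure_nsmul_mul_nsmulMap (PMF.poisson l) w 1
  rw [one_smul] at h
  rw [flood, h]
  exact (PMF.dominated_poisson_succ he he1 hl).map _

theorem negBinomial_absorb (hq0 : 0 < q) {a : ℕ} (ha : a ≤ 2 ^ T) (w : Multiset M) :
    Dominated (ENNReal.ofReal (q ^ 2 ^ T)⁻¹) 0
      (PMF.pure (a • w) * (PMF.negBinomial q hq 1).nsmulMap w)
      ((PMF.negBinomial q hq 1).nsmulMap w) := by
  rw [PMF.pure_nsmul_mul_nsmulMap]
  exact (PMF.negBinomial_one_add_dominated hq hq0 ha).map _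

/-- The noise hides the presence of any message of absolute value at most `2 ^ T`. -/
theorem dominated_noise (he : 0 < e) (he1 : e ≤ 1) (hl : 8 * (1 + L) / e ^ 2 ≤ l) (hq0 : 0 < q)
    {ν : PMF (Multiset M)} (hν : noise c T q hq l 1 ∣ ν) (s : ℤˣ) {a : ℕ} (ha : a ≤ 2 ^ T)
    {X D : ℝ≥0∞} (hX : X = ENNReal.ofReal (Real.exp e) ^ (2 * T + 3) * ENNReal.ofReal (q ^ 2 ^ T)⁻¹)
    (hD : D = (2 * T + 3) * X * ENNReal.ofReal (Real.exp (-L))) :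
    Dominated X D (PMF.pure {c (s * a)} * ν) ν ∧ Dominated X D ν (PMF.pure {c (s * a)} * ν) := by
  set x := ENNReal.ofReal (Real.exp e) with hx
  set y := ENNReal.ofReal (Real.exp (-L)) with hy
  set Q := ENNReal.ofReal (q ^ 2 ^ T)⁻¹ with hQ
  have hx1 : 1 ≤ x := by rw [hx, ENNReal.one_le_ofReal]; exact Real.one_le_exp he.le
  have hQ1 : 1 ≤ Q := by
    rw [hQ, ENNReal.one_le_ofReal]
    exact (one_le_inv₀ (by positivity)).mpr (pow_le_one₀ hq.1 hq.2.le)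
  have hI : ∀ i ∈ a.bitIndices.toFinset, i ∈ range (T + 1) := fun i =>
    mem_range_of_mem_bitIndices ha
  set I := a.bitIndices.toFinset with hIdef
  have hk : I.card ≤ T + 1 := card_bitIndices_le ha
  set k := I.card with hkdef
  have hkE : (k : ℝ≥0∞) ≤ T + 1 := by exact_mod_cast hk
  -- Each direction uses at most `2 * k + 1 ≤ 2 * T + 3` Poisson moves and one geometric move.
  have hXle : ∀ {j : ℕ}, j ≤ 2 * T + 3 → x ^ j * Q ≤ X := fun {j} hj => by
    rw [hX]; gcongr
  have hXle' : ∀ {j : ℕ}, j ≤ 2 * T + 3 → x ^ j ≤ X := fun {j} hj =>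
    (le_mul_of_one_le_right' hQ1).trans (hXle hj)
  have absorbSplit : Dominated x y (PMF.pure (split c s a) * ν) ν :=
    (flood_absorb he he1 hl _).of_dvd ((flood_split_dvd_noise c s ha).trans hν)
  have emitSplit : Dominated x y ν (PMF.pure (split c s a) * ν) :=
    (flood_emit he he1 hl _).of_dvd' ((flood_split_dvd_noise c s ha).trans hν)
  have absorbMerge := Dominated.pure_sum_mul hx1 (merge c (-s)) I fun i hi =>
    (flood_absorb he he1 hl _).of_dvd ((flood_merge_dvd_noise c (-s) (hI i hi)).trans hν)
  have emitMerge := Dominated.le_pure_sum_mul hx1 (merge c (-s)) I fun i hi =>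
    (flood_emit he he1 hl _).of_dvd' ((flood_merge_dvd_noise c (-s) (hI i hi)).trans hν)
  have emitCancel := Dominated.le_pure_sum_mul hx1 (cancel c s) I fun i hi =>
    (flood_emit he he1 hl _).of_dvd' ((flood_cancel_dvd_noise c s (hI i hi)).trans hν)
  have absorbUnits : ∀ s : ℤˣ, Dominated Q 0 (PMF.pure (a • {c s}) * ν) ν := fun s =>
    (negBinomial_absorb hq0 ha _).of_dvd ((negBinomial_dvd_noise c s).trans hν)
  constructor
  -- Deleting the message: the noise emits the merge bundles, the multiset is regrouped by
  -- `add_sum_merge`, and the units and the split bundle are absorbed.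
  · have h1 := emitMerge.mul_left (PMF.pure {c (s * a)})
    rw [← mul_assoc (PMF.pure {c (s * a)}) _ ν, PMF.pure_mul_pure, add_sum_merge,
      ← PMF.pure_mul_pure, mul_assoc (PMF.pure (split c s a)) _ ν] at h1
    refine (h1.trans (((absorbUnits s).mul_left (PMF.pure (split c s a))).trans
      absorbSplit)).mono ?_ ?_
    · calc x ^ k * (Q * x) = x ^ (k + 1) * Q := by ring
        _ ≤ X := hXle (by omega)
    · calc k * x ^ k * y + x ^ k * (0 + Q * y) = k * x ^ k * y + x ^ k * Q * y := by ring
        _ ≤ (T + 1) * X * y + X * y := by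
          gcongr
          · exact hXle' (by omega)
          · exact hXle (by omega)
        _ = (T + 2) * X * y := by ring
        _ ≤ D := by
          rw [hD]; gcongr ?_ * X * y
          norm_cast; omega
  -- Inserting the message: the noise emits the split bundle and the cancelling pairs, the multiset
  -- is regrouped, and everything except the message is absorbed.
  · have h2 := emitCancel.mul_left (PMF.pure (split c s a))
    rw [← mul_assoc (PMF.pure (split c s a)) _ ν, PMF.pure_mul_pure, split_add_sum_cancel,
      ← PMF.pure_mul_pure, ← PMF.pure_mul_pure, mul_assoc (PMF.pure {c (s * a)}) _ ν,
      mul_assoc _ _ ν] at h2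
    have h3 := ((absorbUnits (-s)).mul_left (PMF.pure (∑ i ∈ I, merge c (-s) i))).trans
      absorbMerge
    refine (emitSplit.trans (h2.trans (h3.mul_left (PMF.pure {c (s * a)})))).mono ?_ ?_
    · calc x * (x ^ k * (Q * x ^ k)) = x ^ (2 * k + 1) * Q := by ring
        _ ≤ X := hXle (by omega)
    · calc y + x * (k * x ^ k * y + x ^ k * (0 + Q * (k * x ^ k * y)))
          = x ^ 0 * y + k * x ^ (k + 1) * y + k * (x ^ (2 * k + 1) * Q) * y := by ring
        _ ≤ X * y + (T + 1) * X * y + (T + 1) * X * y := by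
          gcongr
          · exact hXle' (by omega)
          · exact hXle' (by omega)
          · exact hXle (by omega)
        _ = D := by rw [hD]; ring

end Privacy

/-- The number of messages of a multiset. -/
noncomputable def cardHom : Multiset M →+ ℝ≥0∞ :=
  (Nat.castAddMonoidHom ℝ≥0∞).comp Multiset.cardHom

theorem cardHom_apply (s : Multiset M) : cardHom s = (s.card : ℝ≥0∞) := rfl

theorem mean_flood_card (w : Multiset M) : (flood l w).mean cardHom = l * w.card := by
  rw [flood, PMF.mean_nsmulMap, PMF.poisson_mean_cast, cardHom_apply]

/-- There are `2 ^ T + 1` split bundles per sign, each of logarithmic size `T + 2`, and only `T + 1`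
bundles of each of the two other kinds, of size of order `2 ^ T`. -/
theorem mean_noise_card_le :
    (noise c T q hq l r).mean cardHom ≤
      2 * (ENNReal.ofReal (r * (q / (1 - q))) + 6 * (T + 2) * 2 ^ T * l) := by
  have h0 : (cardHom : Multiset M →+ ℝ≥0∞) 0 = 0 := map_zero _
  have hadd : ∀ a b : Multiset M, cardHom (a + b) = cardHom a + cardHom b := map_add _
  have hs : ∀ s : ℤˣ, ∑ a ∈ range (2 ^ T + 1), l * ((split c s a).card : ℝ≥0∞) ≤
      (2 * 2 ^ T) * (l * (T + 2)) := by
    intro s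
    calc ∑ a ∈ range (2 ^ T + 1), l * ((split c s a).card : ℝ≥0∞)
        ≤ ∑ a ∈ range (2 ^ T + 1), (l : ℝ≥0∞) * (T + 2) := by
          refine Finset.sum_le_sum fun a ha => ?_
          gcongr
          exact_mod_cast card_split_le c (T := T) (by simpa [Nat.lt_succ_iff] using ha) s
      _ = ((2 ^ T + 1 : ℕ) : ℝ≥0∞) * (l * (T + 2)) := by simp
      _ ≤ (2 * 2 ^ T) * (l * (T + 2)) := by
          gcongr
          norm_cast
          have := Nat.one_le_two_pow (n := T)
          omega
  have hm : ∀ s : ℤˣ, ∑ i ∈ range (T + 1), ((l : ℝ≥0∞) * (merge c s i).card + l * (cancel c s i).card)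
      ≤ (T + 2) * (l * (4 * 2 ^ T)) := by
    intro s
    calc ∑ i ∈ range (T + 1), ((l : ℝ≥0∞) * (merge c s i).card + l * (cancel c s i).card)
        ≤ ∑ i ∈ range (T + 1), (l : ℝ≥0∞) * (4 * 2 ^ T) := by
          refine Finset.sum_le_sum fun i hi => ?_
          rw [← mul_add, card_merge, card_cancel]
          gcongr
          have h1 : 2 ^ i ≤ 2 ^ T := Nat.pow_le_pow_right two_pos (by
            simpa [Nat.lt_succ_iff] using hi)
          have h2 := Nat.one_le_two_pow (n := T)
          exact_mod_cast (by omega : 1 + 2 ^ i + 2 ^ i * 2 ≤ 4 * 2 ^ T)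
      _ = (T + 1) * (l * (4 * 2 ^ T)) := by simp
      _ ≤ (T + 2) * (l * (4 * 2 ^ T)) := by gcongr; norm_num
  rw [noise, PMF.mean_prod _ _ _ h0 hadd]
  simp only [PMF.mean_mul _ _ _ hadd, PMF.mean_prod _ _ _ h0 hadd, mean_flood_card,
    PMF.mean_nsmulMap, PMF.negBinomial_mean_cast, cardHom_apply, Multiset.card_singleton,
    Nat.cast_one, mul_one]
  calc _ ≤ ∑ _s : ℤˣ, (ENNReal.ofReal (r * (q / (1 - q))) +
        ((2 * 2 ^ T) * (l * (T + 2)) + (T + 2) * (l * (4 * 2 ^ T)) : ℝ≥0∞)) := by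
        refine Finset.sum_le_sum fun s _ => ?_
        gcongr
        · exact hs s
        · exact hm s
    _ = _ := by
        rw [Finset.sum_const, Finset.card_univ, show Fintype.card ℤˣ = 2 from rfl, nsmul_eq_mul]
        push_cast
        ring

section Variance

variable {V : Type*} [NormedAddCommGroup V]

/-- The sum of the values of the messages. -/
def valueHom (val : M → V) : Multiset M →+ V :=
  Multiset.sumAddMonoidHom.comp (Multiset.mapAddMonoidHom val)

theorem valueHom_apply (val : M → V) (s : Multiset M) : valueHom val s = (s.map val).sum := rfl

theorem valueHom_singleton (val : M → V) (m : M) : valueHom val {m} = val m := by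
  simp [valueHom_apply]

variable {c} {val : M → V} {w : V}

theorem map_flood_eq_one {v : Multiset M} (hv : valueHom val v = 0) :
    (flood l v).map (valueHom val) = 1 := by
  rw [flood, PMF.nsmulMap_map, hv, PMF.nsmulMap_zero]

variable [InnerProductSpace ℝ V]

theorem units_abs_natCast (s : ℤˣ) (a : ℕ) : |(s : ℤ) * a| = a := by
  rw [abs_mul, Int.isUnit_iff_abs_eq.mp s.isUnit, one_mul, Nat.abs_cast]

theorem valueHom_unit (hval : ∀ z : ℤ, |z| ≤ 2 ^ T → val (c z) = (z : ℝ) • w) (s : ℤˣ) {a : ℕ}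
    (ha : a ≤ 2 ^ T) : valueHom val {c (s * a)} = ((s : ℤ) * a : ℝ) • w := by
  rw [valueHom_singleton, hval _ (by rw [units_abs_natCast]; exact_mod_cast ha)]
  push_cast
  rfl

theorem valueHom_merge (hval : ∀ z : ℤ, |z| ≤ 2 ^ T → val (c z) = (z : ℝ) • w) (s : ℤˣ) {i : ℕ}
    (hi : i ∈ range (T + 1)) : valueHom val (merge c s i) = 0 := by
  have h1 := valueHom_unit hval s (a := 2 ^ i)
    (Nat.pow_le_pow_right two_pos (by simpa [Nat.lt_succ_iff] using hi))
  have h2 := valueHom_unit hval (-s) (a := 1) Nat.one_le_two_pow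
  push_cast [mul_one] at h1 h2
  rw [merge, map_add, map_nsmul, h1, h2, ← Nat.cast_smul_eq_nsmul ℝ, smul_smul, ← add_smul]
  push_cast
  ring_nf
  simp

theorem valueHom_cancel (hval : ∀ z : ℤ, |z| ≤ 2 ^ T → val (c z) = (z : ℝ) • w) (s : ℤˣ)
    (i : ℕ) : valueHom val (cancel c s i) = 0 := by
  have h1 := valueHom_unit hval s (a := 1) Nat.one_le_two_pow
  have h2 := valueHom_unit hval (-s) (a := 1) Nat.one_le_two_pow
  push_cast [mul_one] at h1 h2
  rw [cancel, map_nsmul, map_add, h1, h2, ← add_smul, add_neg_cancel, zero_smul, smul_zero]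

/-- Values are compared in `add_sum_merge`: merge bundles are worth zero, and `a` units are worth as
much as the message `s * a`. -/
theorem valueHom_split (hval : ∀ z : ℤ, |z| ≤ 2 ^ T → val (c z) = (z : ℝ) • w) (s : ℤˣ) {a : ℕ}
    (ha : a ≤ 2 ^ T) : valueHom val (split c s a) = 0 := by
  have h := congrArg (valueHom val) (add_sum_merge c s a)
  have h2 := valueHom_unit hval s (a := 1) Nat.one_le_two_pow
  push_cast [mul_one] at h2
  rw [map_add, map_add, map_sum, valueHom_unit hval s ha, map_nsmul, h2, Finset.sum_eq_zero
    fun i hi => valueHom_merge hval (-s) (mem_range_of_mem_bitIndices ha hi),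
    ← Nat.cast_smul_eq_nsmul ℝ, smul_smul, mul_comm, add_zero] at h
  exact left_eq_add.mp ((add_comm _ _).trans h.symm).symm

/-- Zero-sum bundles do not contribute. Only the two negative binomial variables of opposite sign
remain; their means cancel and their variances add. -/
theorem hasVarianceLE_noise (hval : ∀ z : ℤ, |z| ≤ 2 ^ T → val (c z) = (z : ℝ) • w) :
    ((noise c T q hq l r).map (valueHom val)).HasVarianceLE 0
      (2 * ENNReal.ofReal (‖w‖ ^ 2 * (r * (q / (1 - q) ^ 2)))) := by
  have h : (noise c T q hq l r).map (valueHom val) =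
      ∏ s : ℤˣ, (PMF.negBinomial q hq r).nsmulMap ((s : ℤ) • w) := by
    rw [noise, ← PMF.mapHom_apply, map_prod]
    refine Finset.prod_congr rfl fun s _ => ?_
    rw [map_mul, map_mul, map_prod, map_prod]
    simp only [map_mul, PMF.mapHom_apply]
    rw [Finset.prod_eq_one fun a ha => map_flood_eq_one
        (valueHom_split hval s (by simpa [Nat.lt_succ_iff] using ha)),
      Finset.prod_eq_one fun i hi => by
        rw [map_flood_eq_one (valueHom_merge hval s hi),
          map_flood_eq_one (valueHom_cancel hval s i), mul_one],
      mul_one, mul_one, PMF.nsmulMap_map]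
    have h2 := valueHom_unit hval s (a := 1) Nat.one_le_two_pow
    push_cast [mul_one] at h2
    rw [h2, Int.cast_smul_eq_zsmul]
  rw [h]
  have h3 := PMF.HasVarianceLE.prod (s := Finset.univ) fun (s : ℤˣ) _ =>
    PMF.hasVarianceLE_negBinomial_smul hq r ((s : ℤ) • w)
  convert! h3 using 1
  · rw [Fintype.sum_equiv (Equiv.refl ℤˣ) _ _ fun _ => rfl]
    simp
  · simp [two_mul]

end Variance

end ZeroSum

/-! ### The error of the Laplace mechanism -/

theorem hasIntegral_pow_mul_laplace {a : ℝ} (ha : 0 < a) (k : ℕ) :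
    Integrable (fun t : ℝ => |t| ^ k * (a / 2 * Real.exp (-(a * |t|)))) ∧
      ∫ t : ℝ, |t| ^ k * (a / 2 * Real.exp (-(a * |t|))) = k.factorial / a ^ k := by
  have h : ∫ t : ℝ, |t| ^ k * (a / 2 * Real.exp (-(a * |t|))) = k.factorial / a ^ k := by
    rw [integral_comp_abs (f := fun t => t ^ k * (a / 2 * Real.exp (-(a * t))))]
    have h1 := Real.integral_rpow_mul_exp_neg_mul_Ioi (a := k + 1) (r := a) (by positivity) ha
    rw [Real.Gamma_nat_eq_factorial] at h1
    have h2 : ∫ t in Set.Ioi (0 : ℝ), t ^ k * (a / 2 * Real.exp (-(a * t))) =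
        a / 2 * ∫ t in Set.Ioi (0 : ℝ), t ^ ((k : ℝ) + 1 - 1) * Real.exp (-(a * t)) := by
      rw [← integral_const_mul]
      congr 1
      ext t
      rw [add_sub_cancel_right, Real.rpow_natCast]
      ring
    rw [h2, h1, ← Nat.cast_succ, Real.rpow_natCast, one_div, inv_pow, pow_succ]
    field_simp
  -- The integral of a non-integrable function is `0` by convention, so a nonzero value proves
  -- integrability.
  refine ⟨Integrable.of_integral_ne_zero ?_, h⟩
  rw [h]
  positivity

theorem lintegral_laplaceDistribution {a : ℝ} (ha : 0 < a) (k : ℕ) :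
    ∫⁻ t, ENNReal.ofReal (|t| ^ k) ∂laplaceDistribution a =
      ENNReal.ofReal (k.factorial / a ^ k) := by
  obtain ⟨h1, h2⟩ := hasIntegral_pow_mul_laplace ha k
  rw [laplaceDistribution, lintegral_withDensity_eq_lintegral_mul _ (by fun_prop) (by fun_prop),
    ← h2, ofReal_integral_eq_lintegral_ofReal h1 (ae_of_all _ fun t => by positivity)]
  refine lintegral_congr fun t => ?_
  rw [Pi.mul_apply, mul_comm, ← ENNReal.ofReal_mul (by positivity)]

theorem isProbabilityMeasure_laplaceDistribution {a : ℝ} (ha : 0 < a) :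
    IsProbabilityMeasure (laplaceDistribution a) :=
  ⟨by simpa using lintegral_laplaceDistribution ha 0⟩

theorem l2Error_laplaceMechanism {a : ℝ} (ha : 0 < a) {d n : ℕ} (v : Fin n → OneSparse d) :
    l2Error (laplaceMechanism a v) (vectorSum v) =
      (ENNReal.ofReal (d * (2 / a ^ 2))) ^ (1 / 2 : ℝ) := by
  have := isProbabilityMeasure_laplaceDistribution ha
  rw [l2Error, laplaceMechanism, lintegral_map (by fun_prop) (by fun_prop)]
  congr 1
  have h : ∀ z : Fin d → ℝ, ‖vectorSum v + WithLp.toLp 2 z - vectorSum v‖ₑ ^ 2 =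
      ∑ j, ENNReal.ofReal (|z j| ^ 2) := by
    intro z
    rw [add_sub_cancel_left, PMF.enorm_sq_eq_ofReal, EuclideanSpace.norm_sq_eq,
      ENNReal.ofReal_sum_of_nonneg fun j _ => by positivity]
    simp
  simp only [h]
  rw [lintegral_finsetSum _ fun j _ => by fun_prop]
  have h2 : ∀ j : Fin d, ∫⁻ z : Fin d → ℝ, ENNReal.ofReal (|z j| ^ 2)
      ∂Measure.pi (fun _ => laplaceDistribution a) = ENNReal.ofReal (2 / a ^ 2) := by
    intro j
    have h3 := (measurePreserving_eval (fun _ : Fin d => laplaceDistribution a) j).lintegral_comp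
      (f := fun t => ENNReal.ofReal (|t| ^ 2)) (by fun_prop)
    exact h3.trans (by simpa using lintegral_laplaceDistribution ha 2)
  simp only [h2, Finset.sum_const, Finset.card_univ, Fintype.card_fin, nsmul_eq_mul]
  rw [ENNReal.ofReal_mul (by positivity), ENNReal.ofReal_natCast]

/-! ### The protocol -/

namespace ZeroSum

open scoped NNReal

theorem exists_code {V : Type*} [AddCommGroup V] {d T b : ℕ} (hb : d * (2 * 2 ^ T + 1) ≤ 2 ^ b)
    (g : Fin d → ℤ → V) :
    ∃ (code : Fin d → ℤ → (Fin b → Bool)) (val : (Fin b → Bool) → V),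
      ∀ j z, |z| ≤ 2 ^ T → val (code j z) = g j z := by
  have hcard : Fintype.card (Fin d × Finset.Icc (-(2 ^ T) : ℤ) (2 ^ T)) ≤
      Fintype.card (Fin b → Bool) := by
    simp only [Fintype.card_prod, Fintype.card_fin, Fintype.card_coe, Int.card_Icc,
      Fintype.card_fun, Fintype.card_bool]
    refine le_trans (Nat.mul_le_mul_left d ?_) hb
    rw [Int.toNat_le]
    push_cast
    linarith
  obtain ⟨φ⟩ := Function.Embedding.nonempty_of_card_le hcard
  -- The default code outside the range may collide with a genuine code; this is harmless because
  -- only integers within the range are ever decoded.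
  refine ⟨fun j z => if h : z ∈ Finset.Icc (-(2 ^ T) : ℤ) (2 ^ T) then φ (j, ⟨z, h⟩) else default,
    Function.extend φ (fun p => g p.1 p.2) 0, fun j z hz => ?_⟩
  have h : z ∈ Finset.Icc (-(2 ^ T) : ℤ) (2 ^ T) := Finset.mem_Icc.mpr (abs_le.mp hz)
  simp only [dif_pos h]
  rw [φ.injective.extend_apply]

theorem exists_units_mul {z : ℤ} {N : ℕ} (hz : |z| ≤ N) : ∃ (s : ℤˣ) (a : ℕ), a ≤ N ∧ z = s * a := by
  have hN : z.natAbs ≤ N := by rw [Int.abs_eq_natAbs] at hz; exact_mod_cast hz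
  rcases Int.natAbs_eq z with h | h
  · exact ⟨1, z.natAbs, hN, by simpa using h⟩
  · exact ⟨-1, z.natAbs, hN, by simpa using h⟩

theorem _root_.OneSparse.exists_eq_smul_single {d : ℕ} (hd : 1 ≤ d) (x : OneSparse d) :
    ∃ (j : Fin d) (t : ℝ), |t| ≤ 1 ∧ x.val = t • EuclideanSpace.single j (1 : ℝ) := by
  obtain ⟨v, hv, hnorm⟩ := x
  have hsub := Set.encard_le_one_iff_subsingleton.mp hv
  obtain ⟨j, hj⟩ : ∃ j, ∀ i, i ≠ j → v i = 0 := by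
    by_cases h : ∃ j, v j ≠ 0
    · obtain ⟨j, hj⟩ := h
      exact ⟨j, fun i hi => by_contra fun hi' => hi (hsub hi' hj)⟩
    · push Not at h
      -- The zero vector has empty support, so an arbitrary coordinate is assigned to it.
      exact ⟨⟨0, hd⟩, fun i _ => h i⟩
  refine ⟨j, v j, ?_, ?_⟩
  · exact (PiLp.norm_apply_le v j).trans hnorm
  · ext i
    by_cases hi : i = j
    · subst hi; simp
    · simp [hj i hi, hi]

theorem exists_rounding {y : ℝ} {N : ℕ} (hN : 1 ≤ N) (hy : |y| ≤ N) :
    ∃ (m : ℤ) (u : ℝ≥0), u ≤ 1 ∧ |m| ≤ N ∧ |m + 1| ≤ N ∧ y = m + u := by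
  obtain ⟨h1, h2⟩ := abs_le.mp hy
  have hN' : (1 : ℤ) ≤ N := by exact_mod_cast hN
  -- At the right endpoint the floor would allow the value `N + 1`; rounding starts from `N - 1`
  -- with probability one of going up.
  by_cases h : y = N
  · refine ⟨N - 1, 1, le_rfl, ?_, ?_, ?_⟩
    · rw [abs_le]; constructor <;> linarith
    · simp
    · rw [h]; push_cast; ring
  · have h3 : (-N : ℤ) ≤ ⌊y⌋ := by rw [Int.le_floor]; push_cast; exact h1
    have h4 : ⌊y⌋ < N := by
      rw [Int.floor_lt]; push_cast; exact lt_of_le_of_ne h2 h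
    refine ⟨⌊y⌋, ⟨Int.fract y, Int.fract_nonneg y⟩, ?_, ?_, ?_, ?_⟩
    · exact_mod_cast (Int.fract_lt_one y).le
    · rw [abs_le]; constructor <;> linarith
    · rw [abs_le]; constructor <;> linarith
    · exact (Int.floor_add_fract y).symm

theorem exists_rounded_entry {d : ℕ} (hd : 1 ≤ d) (T : ℕ) (x : OneSparse d) :
    ∃ (j : Fin d) (m : ℤ) (u : ℝ≥0), u ≤ 1 ∧ |m| ≤ 2 ^ T ∧ |m + 1| ≤ 2 ^ T ∧
      x.val = (m + u : ℝ) • ((2 ^ T : ℝ)⁻¹ • EuclideanSpace.single j (1 : ℝ)) := by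
  obtain ⟨j, t, ht, hx⟩ := x.exists_eq_smul_single hd
  obtain ⟨m, u, hu, hm, hm1, hmu⟩ := exists_rounding (y := t * 2 ^ T) (N := 2 ^ T) Nat.one_le_two_pow
    (by rw [abs_mul, abs_of_pos (by positivity : (0 : ℝ) < 2 ^ T)]; push_cast
        exact mul_le_of_le_one_left (by positivity) ht)
  refine ⟨j, m, u, hu, by exact_mod_cast hm, by exact_mod_cast hm1, ?_⟩
  rw [← hmu, smul_smul, mul_assoc, mul_inv_cancel₀ (by positivity), mul_one, hx]

theorem exp_neg_div_one_sub_le {x : ℝ} (hx : 0 < x) :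
    Real.exp (-x) / (1 - Real.exp (-x)) ≤ 1 / x := by
  have h := Real.add_one_le_exp x
  have h1 : Real.exp (-x) < 1 := by rw [Real.exp_lt_one_iff]; linarith
  rw [div_le_div_iff₀ (by linarith) hx]
  have h2 : Real.exp (-x) * Real.exp x = 1 := by rw [← Real.exp_add]; simp
  nlinarith [Real.exp_pos (-x)]

/-- The left side is `1 / (4 sinh² (x / 2))`, and `sinh y ≥ y` for `y ≥ 0`. This is why discrete
Laplace noise has no larger variance than continuous noise. -/
theorem exp_neg_div_one_sub_sq_le {x : ℝ} (hx : 0 < x) :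
    Real.exp (-x) / (1 - Real.exp (-x)) ^ 2 ≤ 1 / x ^ 2 := by
  have h1 : Real.exp (-x) < 1 := by rw [Real.exp_lt_one_iff]; linarith
  have h2 : Real.exp (-x) = Real.exp (-(x / 2)) ^ 2 := by
    rw [← Real.exp_nat_mul]; congr 1; push_cast; ring
  have h3 : x / 2 ≤ Real.sinh (x / 2) := Real.self_le_sinh_iff.mpr (by linarith)
  rw [Real.sinh_eq] at h3
  have h4 : Real.exp (-(x / 2)) * Real.exp (x / 2) = 1 := by rw [← Real.exp_add]; simp
  have h5 : Real.exp (-(x / 2)) * x ≤ 1 - Real.exp (-x) := by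
    rw [h2]; nlinarith [Real.exp_pos (-(x / 2))]
  rw [div_le_div_iff₀ (by nlinarith) (by positivity), one_mul]
  calc Real.exp (-x) * x ^ 2 = (Real.exp (-(x / 2)) * x) ^ 2 := by rw [h2]; ring
    _ ≤ _ := by gcongr

/-- The message of a user with a rounded input. -/
noncomputable def inputMessage {M : Type*} (c : ℤ → M) (m : ℤ) (u : ℝ≥0) (hu : u ≤ 1) :
    PMF (Multiset M) :=
  (PMF.coin u hu).map fun b => {c (if b then m + 1 else m)}

theorem inputMessage_mul {M : Type*} (c : ℤ → M) (m : ℤ) (u : ℝ≥0) (hu : u ≤ 1)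
    (ν : PMF (Multiset M)) : inputMessage c m u hu * ν =
      (PMF.coin u hu).bind fun b => PMF.pure {c (if b then m + 1 else m)} * ν := by
  rw [inputMessage, ← PMF.bind_pure_comp, PMF.bind_mul]
  rfl

/-- The protocol with its parameters still free: `a` is the price of the geometric noise, `e` that
of one Poisson move. The error bound is the rounding variance plus `d` Laplace variances. -/
theorem exists_protocol {d n T b : ℕ} (hd : 1 ≤ d) (hn : 1 ≤ n)
    (hb : d * (2 * 2 ^ T + 1) ≤ 2 ^ b) {a e L ε δ : ℝ} {l : ℝ≥0} (ha : 0 < a) (he : 0 < e)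
    (he1 : e ≤ 1) (hl : 8 * (1 + L) / e ^ 2 ≤ l) (hε : 2 * ((2 * T + 3) * e + a) ≤ ε)
    (hδ : 2 * (2 * T + 3) * Real.exp (ε - L) ≤ δ) :
    ∃ P : ShuffleProtocol (OneSparse d) (Fin b → Bool) (EuclideanSpace ℝ (Fin d)),
      P.IsShuffleDP n ε δ ∧
      (∀ v : Fin n → OneSparse d, l2Error (P.output v).toMeasure (vectorSum v) ≤
        ENNReal.ofReal (n / (2 ^ T) ^ 2 + d * (2 / a ^ 2)) ^ (1 / 2 : ℝ)) ∧
      ∀ x : OneSparse d, P.expectedMessages x ≤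
        ENNReal.ofReal (1 + d * (2 * (2 ^ T / a + 6 * (T + 2) * 2 ^ T * l)) / n) := by
  set w : Fin d → EuclideanSpace ℝ (Fin d) :=
    fun j => (2 ^ T : ℝ)⁻¹ • EuclideanSpace.single j (1 : ℝ) with hw
  have hwnorm : ∀ j, ‖w j‖ ^ 2 = 1 / (2 ^ T) ^ 2 := fun j => by
    rw [hw, norm_smul, PiLp.norm_single]
    simp
  obtain ⟨code, val, hval⟩ := exists_code hb fun j z => (z : ℝ) • w j
  choose entry m u hu hm hm1 hx using exists_rounded_entry hd T
  -- A shift of the geometric variable by the full range `2 ^ T` then costs exactly `exp a`.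
  set q := Real.exp (-(a / 2 ^ T)) with hqdef
  have hx0 : 0 < a / 2 ^ T := by positivity
  have hq0 : 0 < q := Real.exp_pos _
  have hq : q ∈ Set.Ico (0 : ℝ) 1 := ⟨hq0.le, by rw [hqdef, Real.exp_lt_one_iff]; linarith⟩
  have hqpow : (q ^ 2 ^ T)⁻¹ = Real.exp a := by
    rw [hqdef, ← Real.exp_nat_mul, ← Real.exp_neg]
    congr 1
    push_cast
    field_simp
  have hn0 : (n : ℝ≥0) ≠ 0 := by positivity
  set enc : OneSparse d → PMF (Multiset (Fin b → Bool)) :=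
    fun x => inputMessage (code (entry x)) (m x) (u x) (hu x) with henc
  -- The share of one user; the `n` shares add up to Poisson parameter `l` and to a geometric law.
  set η := ∏ j, noise (code j) T q hq (l / n) (1 / n) with hη
  have hηn : η ^ n = ∏ j, noise (code j) T q hq l 1 := by
    rw [hη, ← Finset.prod_pow]
    refine Finset.prod_congr rfl fun j _ => ?_
    rw [noise_pow, mul_div_cancel₀ _ hn0, mul_one_div_cancel hn0]
  set P : ShuffleProtocol (OneSparse d) (Fin b → Bool) (EuclideanSpace ℝ (Fin d)) :=
    ⟨fun x => enc x * η, fun s => valueHom val (s : Multiset (Fin b → Bool))⟩ with hP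
  refine ⟨P, ?_, ?_, ?_⟩
  · set X := Real.exp ((2 * T + 3) * e + a) with hXdef
    set D := (2 * T + 3) * X * Real.exp (-L) with hDdef
    have hX : ENNReal.ofReal X = ENNReal.ofReal (Real.exp e) ^ (2 * T + 3) *
        ENNReal.ofReal (q ^ 2 ^ T)⁻¹ := by
      rw [hqpow, ← ENNReal.ofReal_pow (Real.exp_pos _).le, ← Real.exp_nat_mul,
        ← ENNReal.ofReal_mul (Real.exp_pos _).le, ← Real.exp_add, hXdef]
      push_cast
      rfl
    have hD : ENNReal.ofReal D = (2 * T + 3) * ENNReal.ofReal X * ENNReal.ofReal (Real.exp (-L)) := by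
      rw [hDdef, ENNReal.ofReal_mul (by positivity), ENNReal.ofReal_mul (by positivity)]
      congr 2
      exact_mod_cast ENNReal.ofReal_natCast (2 * T + 3)
    have key : ∀ (j : Fin d) (z : ℤ), |z| ≤ 2 ^ T →
        Dominated (ENNReal.ofReal X) (ENNReal.ofReal D) (PMF.pure {code j z} * η ^ n) (η ^ n) ∧
        Dominated (ENNReal.ofReal X) (ENNReal.ofReal D) (η ^ n) (PMF.pure {code j z} * η ^ n) := by
      intro j z hz
      obtain ⟨s, t, ht, rfl⟩ := exists_units_mul (N := 2 ^ T) (by exact_mod_cast hz)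
      refine dominated_noise (code j) (hq := hq) he he1 hl hq0 ?_ s ht hX hD
      rw [hηn]
      exact Finset.dvd_prod_of_mem (fun j => noise (code j) T q hq l 1) (Finset.mem_univ j)
    have hz : ∀ (x : OneSparse d) (b : Bool), |if b then m x + 1 else m x| ≤ 2 ^ T := by
      rintro x (_ | _)
      · simpa using hm x
      · simpa using hm1 x
    -- Deleting one input and inserting another each spend half of `ε`.
    have hXε : X ≤ Real.exp (ε / 2) := Real.exp_le_exp.mpr (by linarith)
    have hX1 : 1 ≤ X := Real.one_le_exp (by positivity)
    have hXX : X * X ≤ Real.exp ε := by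
      calc X * X ≤ Real.exp (ε / 2) * Real.exp (ε / 2) := by gcongr
        _ = Real.exp ε := by rw [← Real.exp_add]; ring_nf
    refine P.isShuffleDP_of_dominated n enc η (fun x => rfl) (c := ENNReal.ofReal X)
      (c' := ENNReal.ofReal X) (δ := ENNReal.ofReal D) (δ' := ENNReal.ofReal D)
      (fun x => ?_) (fun x => ?_) ?_ ?_
    · rw [henc]
      simp only [inputMessage_mul]
      exact Dominated.bind_left _ fun b => (key (entry x) _ (hz x b)).1
    · rw [henc]
      simp only [inputMessage_mul]
      exact Dominated.bind_right _ fun b => (key (entry x) _ (hz x b)).2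
    · rw [← ENNReal.ofReal_mul (by positivity)]
      exact ENNReal.ofReal_le_ofReal hXX
    · rw [← ENNReal.ofReal_mul (by positivity), ← ENNReal.ofReal_add (by positivity) (by positivity)]
      apply ENNReal.ofReal_le_ofReal
      refine le_trans ?_ hδ
      have h2 : X + X * X ≤ 2 * Real.exp ε := by nlinarith
      calc D + X * D = (2 * T + 3) * (X + X * X) * Real.exp (-L) := by rw [hDdef]; ring
        _ ≤ (2 * T + 3) * (2 * Real.exp ε) * Real.exp (-L) := by gcongr
        _ = 2 * (2 * T + 3) * Real.exp (ε - L) := by rw [sub_eq_add_neg, Real.exp_add]; ring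
  · intro v
    set σ : ℝ := 1 / (2 ^ T) ^ 2 with hσ
    have henc' : ∀ x, ((enc x).map (valueHom val)).HasVarianceLE x.val (ENNReal.ofReal σ) := by
      intro x
      have h := PMF.hasVarianceLE_coin (u x) (hu x) (m x) (w (entry x))
      rw [← hx x, hwnorm] at h
      convert! h using 1
      simp only [henc, inputMessage, PMF.map_comp]
      congr 1
      ext1 b
      rw [Function.comp_apply, valueHom_singleton]
      cases b
      · simpa using hval (entry x) (m x) (hm x)
      · simpa using hval (entry x) (m x + 1) (hm1 x)
    have hnoise := PMF.HasVarianceLE.prod (s := Finset.univ) fun (j : Fin d) _ =>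
      hasVarianceLE_noise (q := q) (hq := hq) (l := l / n) (r := 1 / n) (hval j)
    have huser : ∀ x, ((P.randomizer x).map (valueHom val)).HasVarianceLE x.val
        (ENNReal.ofReal (σ + d * (2 * (σ * (1 / n * (q / (1 - q) ^ 2)))))) := by
      intro x
      have h := (henc' x).mul hnoise
      rw [Finset.sum_const_zero, add_zero] at h
      have h1 : (P.randomizer x).map (valueHom val) = (enc x).map (valueHom val) *
          ∏ j, (noise (code j) T q hq (l / n) (1 / n)).map (valueHom val) := by
        simp only [hP, hη, PMF.map_mul]
        congr 1
        exact map_prod (PMF.mapHom (valueHom val)) _ _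
      rw [h1]
      refine h.mono (le_of_eq ?_)
      have hq' := hq.1
      simp only [hwnorm, Finset.sum_const, Finset.card_univ, Fintype.card_fin, nsmul_eq_mul]
      rw [ENNReal.ofReal_add (by positivity) (by positivity),
        ENNReal.ofReal_mul (p := (d : ℝ)) (by positivity), ENNReal.ofReal_natCast, ENNReal.ofReal_mul (by positivity : (0 : ℝ) ≤ 2)]
      simp [hσ]
    have htotal := PMF.HasVarianceLE.prod (s := Finset.univ) fun (i : Fin n) _ => huser (v i)
    rw [← P.output_eq_prod (valueHom val) fun _ => rfl] at htotal
    refine htotal.l2Error_le.trans (ENNReal.rpow_le_rpow ?_ (by norm_num))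
    simp only [Finset.sum_const, Finset.card_univ, Fintype.card_fin, nsmul_eq_mul]
    rw [← ENNReal.ofReal_natCast, ← ENNReal.ofReal_mul (by positivity)]
    apply ENNReal.ofReal_le_ofReal
    have hn' : (n : ℝ) ≠ 0 := by positivity
    have h2 := exp_neg_div_one_sub_sq_le hx0
    calc n * (σ + d * (2 * (σ * (1 / n * (q / (1 - q) ^ 2)))))
        = n * σ + d * (2 * (σ * (q / (1 - q) ^ 2))) := by field_simp
      _ ≤ n * σ + d * (2 * (σ * (1 / (a / 2 ^ T) ^ 2))) := by gcongr
      _ = n / (2 ^ T) ^ 2 + d * (2 / a ^ 2) := by rw [hσ]; field_simp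
  · intro x
    have h0 : (cardHom : Multiset (Fin b → Bool) →+ ℝ≥0∞) 0 = 0 := map_zero _
    have hadd : ∀ s t : Multiset (Fin b → Bool), cardHom (s + t) = cardHom s + cardHom t :=
      map_add _
    have h1 : (enc x).mean cardHom = 1 := by
      simp only [henc, inputMessage, PMF.mean_map]
      simp only [PMF.mean, Function.comp_def, cardHom_apply, Multiset.card_singleton, Nat.cast_one,
        mul_one, PMF.tsum_coe]
    have h2 : P.expectedMessages x = (enc x * η).mean cardHom := rfl
    rw [h2, PMF.mean_mul _ _ _ hadd, h1, hη, PMF.mean_prod _ _ _ h0 hadd]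
    have hq' := hq.1
    have hq1 : 0 < 1 - q := by linarith [hq.2]
    have hr : (q / (1 - q)) ≤ 2 ^ T / a := by
      have := exp_neg_div_one_sub_le hx0
      rwa [one_div_div] at this
    calc 1 + ∑ j, (noise (code j) T q hq (l / n) (1 / n)).mean cardHom
        ≤ 1 + ∑ _j : Fin d, 2 * (ENNReal.ofReal ((1 / n : ℝ≥0) * (q / (1 - q))) +
          6 * (T + 2) * 2 ^ T * (l / n : ℝ≥0)) := by
          gcongr
          exact mean_noise_card_le _
      _ = ENNReal.ofReal (1 + d * (2 * ((1 / n) * (q / (1 - q)) +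
            6 * (T + 2) * 2 ^ T * (l / n)))) := by
          rw [ENNReal.ofReal_add (by positivity) (by positivity), ENNReal.ofReal_one,
            ENNReal.ofReal_mul (p := (d : ℝ)) (by positivity), ENNReal.ofReal_natCast,
            ENNReal.ofReal_mul (by positivity : (0 : ℝ) ≤ 2),
            ENNReal.ofReal_add (by positivity) (by positivity)]
          simp only [Finset.sum_const, Finset.card_univ, Fintype.card_fin, nsmul_eq_mul]
          congr 5
          · norm_num
          · have : (6 * (T + 2) * 2 ^ T * (l / n) : ℝ) =
              ((6 * (T + 2) * 2 ^ T * (l / n) : ℝ≥0) : ℝ) := by push_cast; rfl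
            rw [this, ENNReal.ofReal_coe_nnreal]
            push_cast
            rfl
      _ ≤ _ := by
          apply ENNReal.ofReal_le_ofReal
          have hn' : (0 : ℝ) < n := by positivity
          have : d * (2 * ((1 / n) * (q / (1 - q)) + 6 * (T + 2) * 2 ^ T * (l / n))) =
            d * (2 * (q / (1 - q) + 6 * (T + 2) * 2 ^ T * (l : ℝ))) / n := by field_simp
          rw [this]
          gcongr

end ZeroSum

/-! ### Choice of parameters -/

namespace ZeroSum

open scoped NNReal

/-- The rounding error is covered by the slack between two Laplace parameters. -/
theorem rounding_error_le {d n : ℕ} {E ε ζ K N : ℝ} (hd : 1 ≤ d) (hε : 0 < ε) (hεE : ε ≤ E)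
    (hζ : 0 < ζ) (hζ' : ζ < 1 / 2) (hK : K = Real.sqrt n * ((1 + E) / ζ)) (hK0 : 0 < K)
    (hN : K ≤ N) :
    n / N ^ 2 + d * (2 / ((1 - ζ / 2) * ε / 2) ^ 2) ≤ d * (2 / ((1 - ζ) * ε / 2) ^ 2) := by
  have hd' : (1 : ℝ) ≤ d := by exact_mod_cast hd
  have h1 : (n : ℝ) / N ^ 2 ≤ ζ ^ 2 / (1 + E) ^ 2 := by
    have hK2 : K ^ 2 = n * ((1 + E) ^ 2 / ζ ^ 2) := by
      rw [hK, mul_pow, Real.sq_sqrt (Nat.cast_nonneg n), div_pow]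
    calc (n : ℝ) / N ^ 2 ≤ n / K ^ 2 := by gcongr
      _ ≤ ζ ^ 2 / (1 + E) ^ 2 := by
        have hE : 0 < 1 + E := by linarith
        rw [div_le_div_iff₀ (by positivity) (by positivity), hK2]
        apply le_of_eq
        field_simp
  have h2 : ζ ^ 2 / (1 + E) ^ 2 ≤ 8 / ε ^ 2 * ζ ^ 2 := by
    rw [div_eq_inv_mul]
    gcongr
    rw [inv_eq_one_div]
    gcongr
    · norm_num
    · linarith
  -- Over the common denominator, which is at most `1`, the numerator is `ζ - 3 ζ² / 4`, and this is
  -- at least `ζ²` for `ζ < 1 / 2`.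
  have h3 : ζ ^ 2 ≤ 1 / (1 - ζ) ^ 2 - 1 / (1 - ζ / 2) ^ 2 := by
    have ha : 0 < 1 - ζ := by linarith
    have hb : 0 < 1 - ζ / 2 := by linarith
    rw [div_sub_div _ _ (by positivity) (by positivity), le_div_iff₀ (by positivity)]
    have hp : (1 - ζ) ^ 2 * (1 - ζ / 2) ^ 2 ≤ 1 := by
      apply mul_le_one₀ (by nlinarith) (by positivity) (by nlinarith)
    nlinarith [mul_le_mul_of_nonneg_left hp (sq_nonneg ζ)]
  have h4 : 2 / ((1 - ζ) * ε / 2) ^ 2 - 2 / ((1 - ζ / 2) * ε / 2) ^ 2 =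
      8 / ε ^ 2 * (1 / (1 - ζ) ^ 2 - 1 / (1 - ζ / 2) ^ 2) := by
    have ha : 1 - ζ ≠ 0 := by linarith
    have hb : 2 - ζ ≠ 0 := by linarith
    have hb : 1 - ζ / 2 ≠ 0 := by linarith
    field_simp
    ring
  have h5 : 8 / ε ^ 2 * ζ ^ 2 ≤ 8 / ε ^ 2 * (1 / (1 - ζ) ^ 2 - 1 / (1 - ζ / 2) ^ 2) := by gcongr
  have h6 : 0 ≤ 8 / ε ^ 2 * ζ ^ 2 := by positivity
  nlinarith

/-- The number of noise messages, in terms of a common bound `U` for the logarithm of the number of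
users and the inverse privacy parameters. -/
theorem noise_messages_le {G U Λ ε ζ T L : ℝ} (hG : 1 ≤ G) (hU : 1 ≤ U) (hΛ : 1 / 2 ≤ Λ)
    (hε : 0 < ε) (hεG : 1 + ε ≤ G) (hζ : 0 < ζ) (hζ' : ζ < 1 / 2) (hεU : 1 / ε ≤ U)
    (hζU : 1 / ζ ≤ U) (hT0 : 0 ≤ T) (hT : T ≤ 2 * G * U)
    (hL : L = ε + Real.log (2 * (2 * T + 3)) + Λ) :
    1 / ((1 - ζ / 2) * ε / 2) +
      6 * (T + 2) * (8 * (1 + L) / (ζ * ε / (4 * (2 * T + 3) * G)) ^ 2) ≤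
        4666374 * G ^ 6 * U ^ 8 * Λ := by
  have hGU : 1 ≤ G * U := one_le_mul_of_one_le_of_one_le hG hU
  have h1 : 1 / ((1 - ζ / 2) * ε / 2) ≤ 6 * (U * Λ) := by
    calc 1 / ((1 - ζ / 2) * ε / 2) ≤ 1 / (ε / 3) := by
          apply one_div_le_one_div_of_le (by positivity)
          nlinarith
      _ = 3 * (1 / ε) := by field_simp
      _ ≤ 3 * U := by gcongr
      _ ≤ 6 * (U * Λ) := by nlinarith
  have h2 : T + 2 ≤ 4 * (G * U) := by nlinarith
  have h3 : 2 * T + 3 ≤ 7 * (G * U) := by nlinarith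
  have h4 : 1 + L ≤ 31 * (G * U * Λ) := by
    have hlog : Real.log (2 * (2 * T + 3)) ≤ 2 * (2 * T + 3) :=
      (Real.log_le_sub_one_of_pos (by positivity)).trans (by linarith)
    have hGU' : G ≤ G * U := le_mul_of_one_le_right (by linarith) hU
    have h5 : 15 * (G * U) ≤ 30 * (G * U * Λ) := by nlinarith
    have h6 : Λ ≤ G * U * Λ := le_mul_of_one_le_left (by linarith) hGU
    rw [hL]; linarith
  have hinv : 1 / (ζ * ε / (4 * (2 * T + 3) * G)) ≤ 28 * G ^ 2 * U ^ 3 := by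
    calc 1 / (ζ * ε / (4 * (2 * T + 3) * G)) = 4 * (2 * T + 3) * G * ((1 / ζ) * (1 / ε)) := by
          field_simp
      _ ≤ 4 * (7 * (G * U)) * G * (U * U) := by gcongr
      _ = 28 * G ^ 2 * U ^ 3 := by ring
  have h5 : 8 * (1 + L) / (ζ * ε / (4 * (2 * T + 3) * G)) ^ 2 ≤ 194432 * (G ^ 5 * U ^ 7 * Λ) := by
    calc 8 * (1 + L) / (ζ * ε / (4 * (2 * T + 3) * G)) ^ 2
        = 8 * (1 + L) * (1 / (ζ * ε / (4 * (2 * T + 3) * G))) ^ 2 := by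
          rw [one_div_pow, mul_one_div]
      _ ≤ 8 * (31 * (G * U * Λ)) * (28 * G ^ 2 * U ^ 3) ^ 2 := by gcongr
      _ = 194432 * (G ^ 5 * U ^ 7 * Λ) := by ring
  have h6 : U * Λ ≤ G ^ 6 * U ^ 8 * Λ := by
    have ha : (1 : ℝ) ≤ G ^ 6 := one_le_pow₀ hG
    have hb : U ≤ U ^ 8 := le_self_pow₀ hU (by norm_num)
    calc U * Λ ≤ U ^ 8 * Λ := by gcongr
      _ = 1 * U ^ 8 * Λ := by ring
      _ ≤ G ^ 6 * U ^ 8 * Λ := by gcongr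
  have h7 : 0 ≤ 8 * (1 + L) / (ζ * ε / (4 * (2 * T + 3) * G)) ^ 2 := by
    have : 0 ≤ Real.log (2 * (2 * T + 3)) := Real.log_nonneg (by linarith)
    exact div_nonneg (by linarith) (by positivity)
  -- The final constant is `6 + 6 * 4 * 194432`.
  calc _ ≤ 6 * (U * Λ) + 6 * (4 * (G * U)) * (194432 * (G ^ 5 * U ^ 7 * Λ)) := by gcongr
    _ = 6 * (U * Λ) + 4666368 * (G ^ 6 * U ^ 8 * Λ) := by ring
    _ ≤ 6 * (G ^ 6 * U ^ 8 * Λ) + 4666368 * (G ^ 6 * U ^ 8 * Λ) := by gcongr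
    _ = _ := by ring

theorem message_bound_le {d n N G U Λ W : ℝ} (hd : 0 ≤ d) (hn : 0 < n) (hU : 1 ≤ U)
    (hG : 0 ≤ G) (hW0 : 0 ≤ W) (hN : N ≤ 2 * G * U * Real.sqrt n)
    (hW : W ≤ 4666374 * G ^ 6 * U ^ 8 * Λ) :
    d * (2 * (N * W)) / n ≤ 20000000 * G ^ 7 * U ^ 9 * (d * Λ / Real.sqrt n) := by
  have hs : 0 < Real.sqrt n := Real.sqrt_pos.mpr hn
  have hΛ : 0 ≤ G ^ 7 * U ^ 9 * (d * Λ / Real.sqrt n) := by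
    have h : 0 ≤ W * (G * U * (d / Real.sqrt n)) := by positivity
    have h2 := mul_le_mul_of_nonneg_right hW (by positivity : 0 ≤ G * U * (d / Real.sqrt n))
    have h3 : 4666374 * G ^ 6 * U ^ 8 * Λ * (G * U * (d / Real.sqrt n)) =
        4666374 * (G ^ 7 * U ^ 9 * (d * Λ / Real.sqrt n)) := by ring
    linarith
  calc d * (2 * (N * W)) / n
      ≤ d * (2 * ((2 * G * U * Real.sqrt n) * (4666374 * G ^ 6 * U ^ 8 * Λ))) / n := by gcongr
    _ = 18665496 * (G ^ 7 * U ^ 9 * (d * Λ * (Real.sqrt n / n))) := by ring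
    _ = 18665496 * (G ^ 7 * U ^ 9 * (d * Λ / Real.sqrt n)) := by
      rw [Real.sqrt_div_self', mul_one_div]
    _ ≤ _ := by linarith

end ZeroSum

set_option maxHeartbeats 400000 in
theorem corollary3 (E : ℝ) :
    ∃ (C : ℝ) (k : ℕ), ∀ (d n : ℕ) (ε ζ δ : ℝ), 1 ≤ d → 1 ≤ n → 0 < ε → ε ≤ E →
      ζ ∈ Set.Ioo (0 : ℝ) (1 / 2) → δ ∈ Set.Ioo (0 : ℝ) (1 / 2) →
      ∃ (b : ℕ)
        (P : ShuffleProtocol (OneSparse d) (Fin b → Bool) (EuclideanSpace ℝ (Fin d))),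
        (b : ℝ) ≤ Real.logb 2 d + 1 / 2 * Real.logb 2 n + C * Real.log (1 / ζ) ∧
        P.IsShuffleDP n ε δ ∧
        (∀ v : Fin n → OneSparse d,
          l2Error (P.output v).toMeasure (vectorSum v) ≤
            l2Error (laplaceMechanism ((1 - ζ) * ε / 2) v) (vectorSum v)) ∧
        (∀ x : OneSparse d,
          P.expectedMessages x ≤ ENNReal.ofReal
            (1 + C * (1 + Real.log n + 1 / ε + 1 / ζ) ^ k *
              (d * Real.log (1 / δ) / Real.sqrt n))) := by
  have hlog2 : 1 / 2 < Real.log 2 := by linarith [Real.log_two_gt_d9]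
  -- The first summand serves the message length, the second the number of messages; `9` is the
  -- power of `U` in `message_bound_le`.
  refine ⟨(5 + Real.logb 2 (1 + E)) / Real.log 2 + 20000000 * (1 + E) ^ 7, 9, ?_⟩
  intro d n ε ζ δ hd hn hε hεE ⟨hζ, hζ'⟩ ⟨hδ, hδ'⟩
  set G := 1 + E with hG
  have hG1 : 1 ≤ G := by linarith
  have hlogG : 0 ≤ Real.logb 2 G := Real.logb_nonneg one_lt_two hG1
  have hn1 : (1 : ℝ) ≤ n := by exact_mod_cast hn
  have hd1 : (1 : ℝ) ≤ d := by exact_mod_cast hd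
  have hsqrt : 1 ≤ Real.sqrt n := Real.one_le_sqrt.mpr hn1
  have hζinv : 2 ≤ 1 / ζ := by rw [le_div_iff₀ hζ]; linarith
  have hGζ : 1 ≤ G / ζ := by rw [le_div_iff₀ hζ]; linarith
  -- The resolution at which the rounding variance `n / K ^ 2` equals `(ζ / G) ^ 2`.
  set K := Real.sqrt n * (G / ζ) with hK
  have hK1 : 1 ≤ K := one_le_mul_of_one_le_of_one_le hsqrt hGζ
  obtain ⟨T', hT1, hT2⟩ := exists_nat_pow_near hK1 one_lt_two
  obtain ⟨D, hD1, hD2⟩ := exists_nat_pow_near hd1 one_lt_two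
  -- Rounding the exponent up gives `K < 2 ^ T ≤ 2 * K`: the lower bound controls the error, the
  -- upper bound the length and number of messages.
  obtain ⟨T, hT⟩ : ∃ T, T = T' + 1 := ⟨_, rfl⟩
  rw [← hT] at hT2
  have hTK : (2 : ℝ) ^ T ≤ 2 * K := by rw [hT, pow_succ]; linarith
  have hlogK : Real.log K = 1 / 2 * Real.log n + Real.log G + Real.log (1 / ζ) := by
    rw [hK, Real.log_mul (by positivity) (by positivity), Real.log_sqrt (by positivity),
      div_eq_mul_one_div G, Real.log_mul (by positivity) (by positivity)]
    ring
  have hTlog : T * Real.log 2 ≤ Real.log 2 + Real.log K := by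
    rw [← Real.log_pow, ← Real.log_mul (by norm_num) (by positivity)]
    exact Real.log_le_log (by positivity) hTK
  set U := 1 + Real.log n + 1 / ε + 1 / ζ with hU
  have hlogn : 0 ≤ Real.log n := Real.log_nonneg hn1
  have hε' : 0 < 1 / ε := by positivity
  have hU1 : 1 ≤ U := by linarith
  have hTU : (T : ℝ) ≤ 2 * G * U := by
    have h1 : Real.log G ≤ E := by linarith [Real.log_le_sub_one_of_pos (by linarith : 0 < G)]
    have h2 : Real.log (1 / ζ) ≤ 1 / ζ - 1 := Real.log_le_sub_one_of_pos (by positivity)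
    have h3 : Real.log 2 ≤ 1 := by linarith [Real.log_two_lt_d9]
    have h4 : (T : ℝ) * (1 / 2) ≤ T * Real.log 2 := by gcongr
    have h5 : E ≤ E * U := le_mul_of_one_le_right (by linarith) hU1
    have h6 : G * U = U + E * U := by rw [hG]; ring
    linarith
  set Λ := Real.log (1 / δ) with hΛ
  have hΛ1 : 1 / 2 ≤ Λ := by
    refine hlog2.le.trans (Real.log_le_log (by norm_num) ?_)
    rw [le_div_iff₀ hδ]; linarith
  -- Solves `2 * (2 * T + 3) * exp (ε - L) = δ`.
  set L := ε + Real.log (2 * (2 * T + 3)) + Λ with hL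
  -- The Poisson moves of both directions cost `ζ * ε / (2 * G)` in total, at most the `ζ * ε / 2`
  -- left over by the geometric noise; the factor `G` also ensures `e ≤ 1`.
  set e := ζ * ε / (4 * (2 * T + 3) * G) with he
  have hT0 : (0 : ℝ) ≤ T := Nat.cast_nonneg T
  have he0 : 0 < e := by positivity
  have he1 : e ≤ 1 := by
    rw [he, div_le_one (by positivity)]
    calc ζ * ε ≤ 1 * G := by gcongr <;> linarith
      _ ≤ 4 * (2 * T + 3) * G := by gcongr; linarith
  have hL0 : 0 ≤ L := by
    have : 0 ≤ Real.log (2 * (2 * T + 3)) := Real.log_nonneg (by linarith)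
    linarith
  have hb : d * (2 * 2 ^ T + 1) ≤ 2 ^ (D + T + 3) := by
    have h1 : d ≤ 2 ^ (D + 1) := by exact_mod_cast hD2.le
    have h2 : 2 * 2 ^ T + 1 ≤ 2 ^ (T + 2) := by
      have := Nat.one_le_two_pow (n := T)
      rw [pow_add]; omega
    calc d * (2 * 2 ^ T + 1) ≤ 2 ^ (D + 1) * 2 ^ (T + 2) := Nat.mul_le_mul h1 h2
      _ = 2 ^ (D + T + 3) := by rw [← pow_add]; congr 1; ring
  have ha : 0 < (1 - ζ / 2) * ε / 2 := by
    have : 0 < 1 - ζ / 2 := by linarith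
    positivity
  obtain ⟨P, hP1, hP2, hP3⟩ := ZeroSum.exists_protocol (d := d) (n := n) (T := T)
    (b := D + T + 3) (a := (1 - ζ / 2) * ε / 2) (e := e) (L := L) (ε := ε) (δ := δ)
    (l := (8 * (1 + L) / e ^ 2).toNNReal) hd hn hb ha he0 he1 (Real.le_coe_toNNReal _)
    (by
      have h1 : (2 * T + 3) * e ≤ ζ * ε / 4 := by
        have : (2 * T + 3) * e = ζ * ε / (4 * G) := by rw [he]; field_simp
        rw [this]
        gcongr
        linarith
      linarith)
    (by
      have h1 : ε - L = -Real.log (2 * (2 * T + 3)) + Real.log δ := by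
        rw [hL, hΛ, one_div, Real.log_inv]; ring
      rw [h1, Real.exp_add, Real.exp_neg, Real.exp_log (by positivity), Real.exp_log hδ]
      apply le_of_eq
      field_simp)
  refine ⟨D + T + 3, P, ?_, hP1, fun v => ?_, fun x => ?_⟩
  · have hDlog : D * Real.log 2 ≤ Real.log d := by
      rw [← Real.log_pow]
      exact Real.log_le_log (by positivity) hD1
    have hζlog : Real.log 2 ≤ Real.log (1 / ζ) := Real.log_le_log (by norm_num) hζinv
    have hl0 : Real.log 2 ≠ 0 := by linarith
    have hD' : (D : ℝ) ≤ Real.logb 2 d := by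
      rw [Real.logb, le_div_iff₀ (by linarith)]; exact hDlog
    have hT' : (T : ℝ) ≤ 1 + 1 / 2 * Real.logb 2 n + Real.logb 2 G +
        Real.log (1 / ζ) / Real.log 2 := by
      rw [Real.logb, Real.logb, ← mul_le_mul_iff_left₀ (by linarith : 0 < Real.log 2)]
      refine hTlog.trans (le_of_eq ?_)
      rw [hlogK]
      field_simp
      ring
    -- As `ζ < 1 / 2`, additive constants are absorbed into `log (1 / ζ)`: `3` from the code length,
    -- `1` from rounding `T` up, and with the term `log (1 / ζ)` itself they make the `5` in the
    -- constant.
    have h1 : 1 ≤ Real.log (1 / ζ) / Real.log 2 := by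
      rw [le_div_iff₀ (by linarith)]; linarith
    have h2 : (5 + Real.logb 2 G) / Real.log 2 * Real.log (1 / ζ) =
        (5 + Real.logb 2 G) * (Real.log (1 / ζ) / Real.log 2) := by ring
    have h3 : 0 ≤ 20000000 * G ^ 7 * Real.log (1 / ζ) := by
      have : 0 ≤ Real.log (1 / ζ) := by linarith
      positivity
    have h4 : Real.logb 2 G ≤ Real.logb 2 G * (Real.log (1 / ζ) / Real.log 2) :=
      le_mul_of_one_le_right hlogG h1
    push_cast
    rw [add_mul, h2]
    linarith
  · refine (hP2 v).trans ?_
    have ha' : 0 < 1 - ζ := by linarith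
    rw [l2Error_laplaceMechanism (by positivity)]
    refine ENNReal.rpow_le_rpow (ENNReal.ofReal_le_ofReal ?_) (by norm_num)
    exact ZeroSum.rounding_error_le hd hε hεE hζ hζ' hK (by linarith) hT2.le
  · refine (hP3 x).trans (ENNReal.ofReal_le_ofReal ?_)
    rw [Real.coe_toNNReal _ (by positivity)]
    have hmsg := ZeroSum.noise_messages_le (T := T) hG1 hU1 hΛ1 hε (by linarith) hζ hζ'
      (by linarith) (by linarith) hT0 hTU hL
    set W := 1 / ((1 - ζ / 2) * ε / 2) + 6 * (T + 2) * (8 * (1 + L) / e ^ 2) with hW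
    have hTsq : (2 : ℝ) ^ T ≤ 2 * G * U * Real.sqrt n := by
      have : 1 / ζ ≤ U := by linarith
      calc (2 : ℝ) ^ T ≤ 2 * K := hTK
        _ = 2 * G * (1 / ζ) * Real.sqrt n := by rw [hK]; ring
        _ ≤ 2 * G * U * Real.sqrt n := by gcongr
    have h1 : d * (2 * (2 ^ T / ((1 - ζ / 2) * ε / 2) + 6 * (T + 2) * 2 ^ T *
        (8 * (1 + L) / e ^ 2))) / n = d * (2 * (2 ^ T * W)) / n := by rw [hW]; ring
    rw [h1]
    have h3 : (0 : ℝ) ≤ (5 + Real.logb 2 G) / Real.log 2 := by positivity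
    have hW0 : 0 ≤ W := by positivity
    rw [add_le_add_iff_left]
    refine (ZeroSum.message_bound_le (by positivity) (by positivity) hU1 (by linarith) hW0 hTsq
      hmsg).trans ?_
    gcongr
    linarith [pow_nonneg (by linarith : 0 ≤ G) 7]
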